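/- Let $\mathbb F$ be an algebraically closed field of characteristic $p>2$, and let $V=V_{\bar 0}\oplus V_{\bar 1}=\bigoplus_{q\in\frac12\mathbb Z}V_q$ be a $\frac12\mathbb Z$-graded vertex superalgebra over $\mathbb F$: a vertex superalgebra (vacuum $\mathbf 1$, vertex operators $Y(u,z)=\sum_{n\in\mathbb Z}u_nz^{-n-1}$, Jacobi identity with the sign $(-1)^{|u||v|}$) with $\mathbf 1\in V_0$, $V_{\bar 0}=\bigoplus_{q\in\mathbb Z}V_q$, $V_{\bar 1}=\bigoplus_{q\in\frac12+\mathbb Z}V_q$ and $u_kV_n\subset V_{m+n-k-1}$ for $u\in V_m$, $k\in\mathbb Z$. Write $\deg u=q$ for $u\in V_q$, and let $\sigma$ be the parity automorphism, $\sigma=1$ on $V_{\bar 0}$ and $\sigma=-1$ on $V_{\bar 1}$. Let $g$ be an automorphism of the vertex superalgebra $V$ that preserves the $\frac12\mathbb Z$-grading and has finite order prime to $p$. Let $T_0$ be the order of $g\sigma$, let $\varepsilon\in\mathbb F$ be a primitive $T_0$-th root of unity, and for $0\le r<T_0$ put $V^{r*}=\{v\in V: g\sigma(v)=\varepsilon^r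 v\}$, so that $V=\bigoplus_{0\le r<T_0}V^{r*}$. For $\alpha\in\mathbb Q$ with denominator prime to $p$, put $(1+z)^\alpha=\sum_{i\ge0}\binom{\alpha}{i}z^i$, where the binomial coefficients are reduced into $\mathbb F_p\subset\mathbb F$. For $n\in\mathbb N$, $v\in V$ and $u$ homogeneous in both $V=\bigoplus_q V_q$ and $V=\bigoplus_r V^{r*}$, define $$u\circ_g^n v=\begin{cases}\operatorname{Res}_z\frac{(1+z)^{\deg u}}{z^{2+n}}Y(u,z)v,&u\in V^{0*},\\[2pt] \operatorname{Res}_z\frac{(1+z)^{\deg u-1+r/T_0}}{z^{1+n}}Y(u,z)v,&u\in V^{r*},\ 0<r<T_0,\end{cases}\qquad u*_gv=\begin{cases}\operatorname{Res}_z\frac{(1+z)^{\deg u}}{z}Y(u,z)v,&u\in V^{0*},\\[2pt] 0,&u\in V^{r*},\ 0<r<T_0,\end{cases}$$ and extend both linearly in $u$ to $V$. Let $O_g(V)$ be the linear span of all $a\circ_g^n b$ with $a,b\in V$, $n\in\mathbb N$, and let $A_g(V)=V/O_g(V)$. **Theorem.** The subspace $O_g(V)$ is a two-sided ideal of the non-associative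 algebra $(V,*_g)$, and $*_g$ induces on $A_g(V)=V/O_g(V)$ the structure of an associative algebra with identity element $\mathbf 1+O_g(V)$. Moreover the parity of $V$ induces a $\mathbb Z/2$-grading on $A_g(V)$ (that is, $A_g(V)$ is the direct sum of the images of $V_{\bar 0}$ and $V_{\bar 1}$) which makes $A_g(V)$ an associative superalgebra. -/

import Mathlib

/-- The projection onto the `i`-th summand of an internal direct sum decomposition. -/
noncomputable def componentMap {F V ι : Type*} [Field F] [AddCommGroup V] [Module F V]
    [DecidableEq ι] {M : ι → Submodule F V} (h : DirectSum.IsInternal M) (i : ι) : V →ₗ[F] V :=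
  (M i).subtype ∘ₗ DirectSum.component F ι (fun j => M j) i ∘ₗ
    (LinearEquiv.ofBijective (DirectSum.coeLinearMap M) h).symm.toLinearMap

/-- The linear extension of a family of linear maps, the `i`-th of which is used on the `i`-th
summand of an internal direct sum decomposition. -/
noncomputable def extendBySummands {F V W ι : Type*} [Field F] [AddCommGroup V] [Module F V]
    [AddCommGroup W] [Module F W] [DecidableEq ι] {M : ι → Submodule F V}
    (h : DirectSum.IsInternal M) (L : ι → V →ₗ[F] W) : V →ₗ[F] W :=
  DirectSum.toModule F ι W (fun i => L i ∘ₗ (M i).subtype) ∘ₗ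
    (LinearEquiv.ofBijective (DirectSum.coeLinearMap M) h).symm.toLinearMap

theorem internal_symm_apply {F V ι : Type*} [Field F] [AddCommGroup V] [Module F V]
    [DecidableEq ι] {M : ι → Submodule F V} (h : DirectSum.IsInternal M) {i : ι} (x : M i) :
    (LinearEquiv.ofBijective (DirectSum.coeLinearMap M) h).symm (x : V) =
      DirectSum.lof F ι (fun j => M j) i x := by
  rw [LinearEquiv.symm_apply_eq]
  exact (DirectSum.coeLinearMap_lof M i x).symm

theorem componentMap_mem {F V ι : Type*} [Field F] [AddCommGroup V] [Module F V]
    [DecidableEq ι] {M : ι → Submodule F V} (h : DirectSum.IsInternal M) (i : ι) (v : V) :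
    componentMap h i v ∈ M i := by
  simp [componentMap]

theorem componentMap_same {F V ι : Type*} [Field F] [AddCommGroup V] [Module F V]
    [DecidableEq ι] {M : ι → Submodule F V} (h : DirectSum.IsInternal M) {i : ι} {v : V}
    (hv : v ∈ M i) : componentMap h i v = v := by
  have := internal_symm_apply h ⟨v, hv⟩
  simp only at this
  simp [componentMap, this, DirectSum.component.lof_self]

theorem componentMap_of_ne {F V ι : Type*} [Field F] [AddCommGroup V] [Module F V]
    [DecidableEq ι] {M : ι → Submodule F V} (h : DirectSum.IsInternal M) {i j : ι} (hij : i ≠ j)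
    {v : V} (hv : v ∈ M j) : componentMap h i v = 0 := by
  have := internal_symm_apply h ⟨v, hv⟩
  simp only at this
  simp [componentMap, this, DirectSum.component.of, hij.symm]

theorem extendBySummands_of_mem {F V W ι : Type*} [Field F] [AddCommGroup V] [Module F V]
    [AddCommGroup W] [Module F W] [DecidableEq ι] {M : ι → Submodule F V}
    (h : DirectSum.IsInternal M) (L : ι → V →ₗ[F] W) {i : ι} {v : V} (hv : v ∈ M i) :
    extendBySummands h L v = L i v := by
  have := internal_symm_apply h ⟨v, hv⟩
  simp only at this
  simp [extendBySummands, this, DirectSum.toModule_lof]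

theorem componentMap_sum_zmod_two {F V : Type*} [Field F] [AddCommGroup V] [Module F V]
    {M : ZMod 2 → Submodule F V} (h : DirectSum.IsInternal M) (v : V) :
    componentMap h 0 v + componentMap h 1 v = v := by
  have hv : v ∈ ⨆ i, M i := by rw [h.submodule_iSup_eq_top]; trivial
  induction hv using Submodule.iSup_induction' with
  | mem i x hx =>
    fin_cases i
    · have h0 : x ∈ M 0 := hx
      rw [componentMap_same h h0, componentMap_of_ne h one_ne_zero h0, add_zero]
    · have h1 : x ∈ M 1 := hx
      rw [componentMap_same h h1, componentMap_of_ne h zero_ne_one h1, zero_add]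
  | zero => simp
  | add x y _ _ hx hy =>
    rw [map_add, map_add]
    nth_rewrite 3 [← hx]
    nth_rewrite 3 [← hy]
    abel

/-- A vertex superalgebra structure on the vector space `V`. The coefficient of `x ^ (-n-1)` in
`Y(u,x)` is `u_n = VertexOperator.ncoeff (Y u) n`; the truncation condition (`u_n v = 0` for `n`
large) is part of Mathlib's `VertexOperator`. -/
structure VertexSuperalgebra (F V : Type*) [Field F] [AddCommGroup V] [Module F V] where
  /-- the `ℤ/2`-grading -/
  parity : ZMod 2 → Submodule F V
  parity_isInternal : DirectSum.IsInternal parity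
  /-- the vacuum vector -/
  vac : V
  vac_mem_parity : vac ∈ parity 0
  /-- the state-field correspondence -/
  Y : V →ₗ[F] VertexOperator F V
  parity_ncoeff : ∀ (α β : ZMod 2), ∀ u ∈ parity α, ∀ v ∈ parity β, ∀ n : ℤ,
    VertexOperator.ncoeff (Y u) n v ∈ parity (α + β)
  /-- `Y(1,x)` is the identity operator -/
  vacuum : ∀ (n : ℤ) (v : V), VertexOperator.ncoeff (Y vac) n v = if n = -1 then v else 0
  /-- `Y(v,x)1` has no negative powers of `x` -/
  creation_regular : ∀ (v : V) (n : ℤ), 0 ≤ n → VertexOperator.ncoeff (Y v) n vac = 0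
  /-- `Y(v,x)1` has constant term `v` -/
  creation : ∀ v : V, VertexOperator.ncoeff (Y v) (-1) vac = v
  /-- The Jacobi identity for parity-homogeneous `u` and `v`: this is the equality of the
  coefficients of `x₀^(-l-1) x₁^(-m-1) x₂^(-n-1)` on its two sides, applied to `w`. By truncation
  all the sums are finite. -/
  jacobi : ∀ (α β : ZMod 2), ∀ u ∈ parity α, ∀ v ∈ parity β, ∀ (w : V) (l m n : ℤ),
    (∑ᶠ i : ℕ, ((-1) ^ i * Ring.choose l i : ℤ) •
        VertexOperator.ncoeff (Y u) (l + m - i) (VertexOperator.ncoeff (Y v) (n + i) w)) -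
      (-1 : ℤ) ^ (α.val * β.val) •
        (∑ᶠ i : ℕ, ((l.negOnePow : ℤ) * (-1) ^ i * Ring.choose l i : ℤ) •
          VertexOperator.ncoeff (Y v) (l + n - i) (VertexOperator.ncoeff (Y u) (m + i) w)) =
    ∑ᶠ i : ℕ, (Ring.choose m i : ℤ) •
        VertexOperator.ncoeff (Y (VertexOperator.ncoeff (Y u) (l + i) v)) (m + n - i) w

/-- A `½ℤ`-graded vertex superalgebra. The homogeneous subspace of degree `k / 2` is
`halfDeg k`, for `k : ℤ`. -/
structure HalfGradedVertexSuperalgebra (F V : Type*) [Field F] [AddCommGroup V] [Module F V]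
    extends VertexSuperalgebra F V where
  /-- `halfDeg k` is the subspace of degree `k / 2` -/
  halfDeg : ℤ → Submodule F V
  halfDeg_isInternal : DirectSum.IsInternal halfDeg
  vac_mem_halfDeg : vac ∈ halfDeg 0
  parity_zero_eq : parity 0 = ⨆ n : ℤ, halfDeg (2 * n)
  parity_one_eq : parity 1 = ⨆ n : ℤ, halfDeg (2 * n + 1)
  /-- `u_k V_n ⊆ V_{m+n-k-1}` for `u ∈ V_m`, where `m = a / 2` and `n = b / 2` -/
  halfDeg_ncoeff : ∀ (a b : ℤ), ∀ u ∈ halfDeg a, ∀ v ∈ halfDeg b, ∀ k : ℤ,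
    VertexOperator.ncoeff (Y u) k v ∈ halfDeg (a + b - 2 * k - 2)

namespace VertexSuperalgebra

/-- The `n`-th product `(u, v) ↦ u_n v`. -/
noncomputable def mode {F V : Type*} [Field F] [AddCommGroup V] [Module F V]
    (A : VertexSuperalgebra F V) (n : ℤ) : V →ₗ[F] V →ₗ[F] V :=
  LinearMap.proj n ∘ₗ VertexOperator.ncoeff ∘ₗ A.Y

theorem mode_apply {F V : Type*} [Field F] [AddCommGroup V] [Module F V]
    (A : VertexSuperalgebra F V) (n : ℤ) (u v : V) :
    A.mode n u v = VertexOperator.ncoeff (A.Y u) n v := rfl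

theorem truncation {F V : Type*} [Field F] [AddCommGroup V] [Module F V]
    (A : VertexSuperalgebra F V) (u v : V) : ∃ N : ℤ, ∀ n : ℤ, N ≤ n → A.mode n u v = 0 := by
  refine ⟨-(HahnSeries.order ((HahnModule.of F).symm (A.Y u v))), fun n hn => ?_⟩
  exact VertexOperator.ncoeff_eq_zero_of_lt_order _ _ _ (by omega)

/-- `g` is an automorphism of the vertex superalgebra. -/
def IsAutomorphism {F V : Type*} [Field F] [AddCommGroup V] [Module F V]
    (A : VertexSuperalgebra F V) (g : V ≃ₗ[F] V) : Prop :=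
  g A.vac = A.vac ∧ ∀ (u v : V) (n : ℤ), g (A.mode n u v) = A.mode n (g u) (g v)

/-- The parity automorphism `σ`, equal to `1` on the even and to `-1` on the odd part. -/
noncomputable def sigma {F V : Type*} [Field F] [AddCommGroup V] [Module F V]
    (A : VertexSuperalgebra F V) : V ≃ₗ[F] V :=
  LinearEquiv.ofInvolutive
    (componentMap A.parity_isInternal 0 - componentMap A.parity_isInternal 1) (by
      intro v
      have h0 := componentMap_mem A.parity_isInternal 0 v
      have h1 := componentMap_mem A.parity_isInternal 1 v
      simp only [LinearMap.sub_apply, map_sub]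
      rw [componentMap_same _ h0, componentMap_same _ h1,
        componentMap_of_ne _ zero_ne_one h1, componentMap_of_ne _ one_ne_zero h0]
      simpa using componentMap_sum_zmod_two A.parity_isInternal v)

/-- The residue `Res_z (1+z)^α z^(-m) Y(u,z)v = ∑ᵢ binom(α,i) u_{i-m} v`, bilinear in `u`, `v`.
The binomial coefficient is computed in `ℚ` and then mapped to `F` by `a/b ↦ (a : F)/(b : F)`,
which is the canonical map on rationals whose denominator is prime to the characteristic. -/
noncomputable def res {F V : Type*} [Field F] [AddCommGroup V] [Module F V]
    (A : VertexSuperalgebra F V) (α : ℚ) (m : ℤ) : V →ₗ[F] V →ₗ[F] V :=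
  have fin : ∀ u v : V, (Function.support fun i : ℕ =>
      ((Ring.choose α i : ℚ) : F) • A.mode (i - m) u v).Finite := fun u v => by
    obtain ⟨N, hN⟩ := A.truncation u v
    refine (Set.finite_lt_nat (N + m).toNat).subset fun i hi => ?_
    by_contra hlt
    simp only [Set.mem_ofPred_eq, not_lt] at hlt
    exact hi (by simp only [hN (i - m) (by omega), smul_zero])
  LinearMap.mk₂ F (fun u v => ∑ᶠ i : ℕ, ((Ring.choose α i : ℚ) : F) • A.mode (i - m) u v)
    (fun u u' v => by
      rw [← finsum_add_distrib (fin u v) (fin u' v)]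
      simp only [map_add, LinearMap.add_apply, smul_add])
    (fun c u v => by
      rw [smul_finsum' c (fin u v)]
      simp only [map_smul, LinearMap.smul_apply, smul_comm c])
    (fun u v v' => by
      rw [← finsum_add_distrib (fin u v) (fin u v')]
      simp only [map_add, smul_add])
    (fun c u v => by
      rw [smul_finsum' c (fin u v)]
      simp only [map_smul, smul_comm c])

theorem res_apply {F V : Type*} [Field F] [AddCommGroup V] [Module F V]
    (A : VertexSuperalgebra F V) (α : ℚ) (m : ℤ) (u v : V) :
    A.res α m u v = ∑ᶠ i : ℕ, ((Ring.choose α i : ℚ) : F) • A.mode (i - m) u v := rfl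

/-- The order `T₀` of `g σ`. -/
noncomputable def T₀ {F V : Type*} [Field F] [AddCommGroup V] [Module F V]
    (A : VertexSuperalgebra F V) (g : V ≃ₗ[F] V) : ℕ := orderOf (g * A.sigma)

/-- The subspace `V^{r*}`, the eigenspace of `g σ` for the eigenvalue `ε ^ r`. -/
noncomputable def starSpace {F V : Type*} [Field F] [AddCommGroup V] [Module F V]
    (A : VertexSuperalgebra F V) (g : V ≃ₗ[F] V) (ε : F) (r : ℕ) : Submodule F V :=
  Module.End.eigenspace ((g * A.sigma : V ≃ₗ[F] V) : V →ₗ[F] V) (ε ^ r)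

/-- The projection of `V` onto the eigenspace `V^{r*}`, for `ε` a primitive `T₀`-th root of unity,
as an average over the powers of `g σ`. -/
noncomputable def starProj {F V : Type*} [Field F] [AddCommGroup V] [Module F V]
    (A : VertexSuperalgebra F V) (g : V ≃ₗ[F] V) (ε : F) (r : ℕ) : V →ₗ[F] V :=
  (A.T₀ g : F)⁻¹ • ∑ j ∈ Finset.range (A.T₀ g),
    ((ε ^ (r * j))⁻¹ : F) • (((g * A.sigma) ^ j : V ≃ₗ[F] V) : V →ₗ[F] V)

theorem pow_apply_of_mem_starSpace {F V : Type*} [Field F] [AddCommGroup V] [Module F V]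
    (A : VertexSuperalgebra F V) (g : V ≃ₗ[F] V) (ε : F) {r : ℕ} {u : V}
    (hu : u ∈ A.starSpace g ε r) (j : ℕ) :
    ((g * A.sigma) ^ j : V ≃ₗ[F] V) u = ε ^ (r * j) • u := by
  have h1 : (g * A.sigma : V ≃ₗ[F] V) u = ε ^ r • u := Module.End.mem_eigenspace_iff.1 hu
  induction j with
  | zero => simp
  | succ j ih =>
    rw [pow_succ, LinearEquiv.mul_apply, h1, map_smul, ih, smul_smul, ← pow_add]
    congr 2
    ring

theorem starProj_of_mem {F V : Type*} [Field F] [AddCommGroup V] [Module F V]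
    (A : VertexSuperalgebra F V) (g : V ≃ₗ[F] V) {ε : F} (hε : IsPrimitiveRoot ε (A.T₀ g))
    (hT : (A.T₀ g : F) ≠ 0) {r s : ℕ} (hr : r < A.T₀ g) (hs : s < A.T₀ g) {u : V}
    (hu : u ∈ A.starSpace g ε s) : A.starProj g ε r u = if r = s then u else 0 := by
  have hpos : 0 < A.T₀ g := by omega
  have hε0 : ε ≠ 0 := hε.ne_zero hpos.ne'
  have key : A.starProj g ε r u =
      ((A.T₀ g : F)⁻¹ * ∑ j ∈ Finset.range (A.T₀ g), (ε ^ s / ε ^ r) ^ j) • u := by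
    simp only [starProj, LinearMap.smul_apply, LinearMap.sum_apply, LinearEquiv.coe_coe,
      A.pow_apply_of_mem_starSpace g ε hu, smul_smul, ← Finset.sum_smul]
    congr 2
    refine Finset.sum_congr rfl fun j _ => ?_
    rw [div_pow, ← pow_mul, ← pow_mul, div_eq_mul_inv, mul_comm]
  rw [key]
  split_ifs with h
  · subst h
    rw [div_self (pow_ne_zero _ hε0)]
    simp [hT]
  · have hne : ε ^ s / ε ^ r ≠ 1 := by
      intro h1
      rw [div_eq_one_iff_eq (pow_ne_zero _ hε0)] at h1
      exact h (hε.pow_inj hr hs h1.symm)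
    have h1 : (ε ^ s / ε ^ r) ^ A.T₀ g = 1 := by
      rw [div_pow, ← pow_mul, ← pow_mul, mul_comm s, mul_comm r, pow_mul, pow_mul, hε.pow_eq_one]
      simp
    rw [geom_sum_eq hne, h1]
    simp

end VertexSuperalgebra

namespace HalfGradedVertexSuperalgebra

/-- `u ∘_g^n v`: the linear extension in `u` of
`Res_z (1+z)^(deg u) z^(-2-n) Y(u,z)v` for homogeneous `u ∈ V^{0*}` and of
`Res_z (1+z)^(deg u - 1 + r/T₀) z^(-1-n) Y(u,z)v` for homogeneous `u ∈ V^{r*}`, `0 < r < T₀`. -/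
noncomputable def circ {F V : Type*} [Field F] [AddCommGroup V] [Module F V]
    (A : HalfGradedVertexSuperalgebra F V) (g : V ≃ₗ[F] V) (ε : F) (n : ℕ) :
    V →ₗ[F] V →ₗ[F] V :=
  extendBySummands A.halfDeg_isInternal fun k : ℤ =>
    A.res ((k : ℚ) / 2) (2 + n) ∘ₗ A.starProj g ε 0 +
    ∑ r ∈ Finset.Ico 1 (A.T₀ g),
      A.res ((k : ℚ) / 2 - 1 + (r : ℚ) / (A.T₀ g : ℚ)) (1 + n) ∘ₗ A.starProj g ε r

/-- `u *_g v`: the linear extension in `u` of `Res_z (1+z)^(deg u) z^(-1) Y(u,z)v` for homogeneous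
`u ∈ V^{0*}` and of `0` for `u ∈ V^{r*}`, `0 < r < T₀`. -/
noncomputable def star {F V : Type*} [Field F] [AddCommGroup V] [Module F V]
    (A : HalfGradedVertexSuperalgebra F V) (g : V ≃ₗ[F] V) (ε : F) : V →ₗ[F] V →ₗ[F] V :=
  extendBySummands A.halfDeg_isInternal fun k : ℤ =>
    A.res ((k : ℚ) / 2) 1 ∘ₗ A.starProj g ε 0

/-- `O_g(V)`, the span of all `a ∘_g^n b`. -/
noncomputable def O {F V : Type*} [Field F] [AddCommGroup V] [Module F V]
    (A : HalfGradedVertexSuperalgebra F V) (g : V ≃ₗ[F] V) (ε : F) : Submodule F V :=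
  Submodule.span F {x | ∃ (n : ℕ) (a b : V), x = A.circ g ε n a b}

theorem circ_of_mem_zero {F V : Type*} [Field F] [AddCommGroup V] [Module F V]
    (A : HalfGradedVertexSuperalgebra F V) (g : V ≃ₗ[F] V) {ε : F}
    (hε : IsPrimitiveRoot ε (A.T₀ g)) (hT : (A.T₀ g : F) ≠ 0) (n : ℕ) {k : ℤ} {u : V}
    (hu : u ∈ A.halfDeg k) (hu' : u ∈ A.starSpace g ε 0) (v : V) :
    A.circ g ε n u v = A.res ((k : ℚ) / 2) (2 + n) u v := by
  have hpos : 0 < A.T₀ g := Nat.pos_of_ne_zero fun h => hT (by simp [h])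
  rw [circ, extendBySummands_of_mem _ _ hu, LinearMap.add_apply, LinearMap.sum_apply,
    Finset.sum_eq_zero, add_zero, LinearMap.comp_apply, A.starProj_of_mem g hε hT hpos hpos hu',
    if_pos rfl]
  intro r hr
  obtain ⟨h1, h2⟩ := Finset.mem_Ico.1 hr
  rw [LinearMap.comp_apply, A.starProj_of_mem g hε hT h2 hpos hu', if_neg (by omega), map_zero]

theorem circ_of_mem_ne_zero {F V : Type*} [Field F] [AddCommGroup V] [Module F V]
    (A : HalfGradedVertexSuperalgebra F V) (g : V ≃ₗ[F] V) {ε : F}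
    (hε : IsPrimitiveRoot ε (A.T₀ g)) (hT : (A.T₀ g : F) ≠ 0) (n : ℕ) {k : ℤ} {r : ℕ}
    (hr0 : r ≠ 0) (hr : r < A.T₀ g) {u : V} (hu : u ∈ A.halfDeg k)
    (hu' : u ∈ A.starSpace g ε r) (v : V) :
    A.circ g ε n u v = A.res ((k : ℚ) / 2 - 1 + (r : ℚ) / (A.T₀ g : ℚ)) (1 + n) u v := by
  have hpos : 0 < A.T₀ g := by omega
  rw [circ, extendBySummands_of_mem _ _ hu, LinearMap.add_apply, LinearMap.sum_apply,
    Finset.sum_eq_single_of_mem r (Finset.mem_Ico.2 ⟨by omega, hr⟩), LinearMap.comp_apply,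
    LinearMap.comp_apply, A.starProj_of_mem g hε hT hpos hr hu',
    A.starProj_of_mem g hε hT hr hr hu', if_neg (Ne.symm hr0), if_pos rfl, map_zero, zero_add]
  intro s hs hsr
  rw [LinearMap.comp_apply, A.starProj_of_mem g hε hT (Finset.mem_Ico.1 hs).2 hr hu', if_neg hsr,
    map_zero]

theorem star_of_mem {F V : Type*} [Field F] [AddCommGroup V] [Module F V]
    (A : HalfGradedVertexSuperalgebra F V) (g : V ≃ₗ[F] V) {ε : F}
    (hε : IsPrimitiveRoot ε (A.T₀ g)) (hT : (A.T₀ g : F) ≠ 0) {k : ℤ} {r : ℕ}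
    (hr : r < A.T₀ g) {u : V} (hu : u ∈ A.halfDeg k) (hu' : u ∈ A.starSpace g ε r) (v : V) :
    A.star g ε u v = if r = 0 then A.res ((k : ℚ) / 2) 1 u v else 0 := by
  rw [star, extendBySummands_of_mem _ _ hu, LinearMap.comp_apply,
    A.starProj_of_mem g hε hT (by omega) hr hu']
  by_cases h : r = 0
  · rw [if_pos h.symm, if_pos h]
  · rw [if_neg (Ne.symm h), if_neg h, map_zero, LinearMap.zero_apply]

end HalfGradedVertexSuperalgebra

/-!
The proof is a residue calculus that works in characteristic `p` because all exponents of `1 + z`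
are `p`-integral rational numbers. It uses neither skew symmetry nor a translation operator.

Multiplying the Jacobi identity by `(1 + z)^α (1 + w)^β` gives an identity between residues of
`(1 + z)^α z^m (1 + w)^β w^n (z - w)^l`, expanded in the three usual domains
(`VertexSuperalgebra.eventually_jacobi_res_res`). For this only the Chu-Vandermonde identity is
needed, and it survives reduction modulo `p` because `ℤ_[p]` is a binomial ring
(`choose_mem_pIntegers`, `binom_add`).

Let `e` be the exponent of `1 + z` and `d` the order of the pole in `u ∘_g^0 v`. Since `O_g(V)`
contains `u ∘_g^n v` for every `n`, Pascal's rule shows that it contains every residue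
`Res_z (1 + z)^(e + s) z^(-d - n) Y(u,z)v` with `s ≤ n` (`res_mem_O`). Everything else is a choice
of exponents in the Jacobi identity.

* With `l = 0`, `m = -1` it expresses the commutator of `a *_g` and `u ∘_g^n` through such residues,
  so `O_g(V)` is a left ideal (`star_circ_mem_O`).
* With `m = 0`, `n = -1` it is an iterate formula for `(Res_z (1 + z)^α z^(-M) Y(u,z)v) *_g w`
  (`eventually_star_res`). Taking `u ∘_g^n v` for the inner residue, all terms lie in `O_g(V)`, so
  `O_g(V)` is a right ideal. The case `u ∈ V^{r*}`, `v ∈ V^{s*}` with `r + s = T₀` works because the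
  exponents `r / T₀` and `s / T₀` add up to `1`. Taking `u *_g v`, all terms but
  `u *_g (v *_g w)` lie in `O_g(V)`, which is associativity.
* If `u ∈ V^{r*}` with `0 < r < T₀`, then `u = u ∘_g^0 1` lies in `O_g(V)`, while
  `u *_g 1 = u` on `V^{0*}`; hence the vacuum is the identity.

Finally `g` preserves parity, so all the products respect it and `O_g(V)` is a graded subspace.
-/

/-! ### Binomial coefficients modulo `p` -/

/-- The binomial coefficient `binom(α, i)`, computed in `ℚ` and mapped to `F` by
`a/b ↦ (a : F)/(b : F)`. It satisfies the usual identities only for `α` with denominator prime to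
the characteristic of `F`. -/
noncomputable def binom (F : Type*) [Field F] (α : ℚ) (i : ℕ) : F := ((Ring.choose α i : ℚ) : F)

/-- The ring of rational numbers whose denominator is prime to `p`. -/
noncomputable def pIntegers (p : ℕ) [Fact p.Prime] : Subring ℚ := (Rat.padicValuation p).integer

section Binom

variable {F : Type*} [Field F] {p : ℕ} [Fact p.Prime]

theorem mem_pIntegers_iff {q : ℚ} : q ∈ pIntegers p ↔ ¬ p ∣ q.den :=
  Rat.padicValuation_le_one_iff

theorem den_ne_zero_of_mem_pIntegers [CharP F p] {q : ℚ} (hq : q ∈ pIntegers p) :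
    (q.den : F) ≠ 0 := by
  rw [Ne, CharP.cast_eq_zero_iff F p]
  exact mem_pIntegers_iff.1 hq

theorem intCast_div_natCast_mem_pIntegers [CharP F p] (a : ℤ) {n : ℕ} (hn : (n : F) ≠ 0) :
    (a : ℚ) / n ∈ pIntegers p := by
  rw [Ne, CharP.cast_eq_zero_iff F p] at hn
  rw [div_eq_mul_inv]
  refine (pIntegers p).mul_mem (intCast_mem _ a) (mem_pIntegers_iff.2 fun h => hn ?_)
  rcases Nat.eq_zero_or_pos n with rfl | hpos
  · exact dvd_zero p
  · rwa [Rat.inv_natCast_den_of_pos hpos] at h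

/-- A binomial coefficient with `p`-integral upper argument is `p`-integral, because `ℤ_[p]` is a
binomial ring. -/
theorem choose_mem_pIntegers {α : ℚ} (hα : α ∈ pIntegers p) (i : ℕ) :
    Ring.choose α i ∈ pIntegers p := by
  have h1 : ‖(α : ℚ_[p])‖ ≤ 1 := Padic.norm_rat_le_one (mem_pIntegers_iff.1 hα)
  set a : ℤ_[p] := ⟨α, h1⟩ with ha
  have h2 : ((Ring.choose a i : ℤ_[p]) : ℚ_[p]) = ((Ring.choose α i : ℚ) : ℚ_[p]) := by
    have e1 := Ring.map_choose (PadicInt.Coe.ringHom (p := p)) a i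
    have e2 := Ring.map_choose (Rat.castHom ℚ_[p]) α i
    exact e1.trans e2.symm
  have h3 : ‖((Ring.choose α i : ℚ) : ℚ_[p])‖ ≤ 1 := h2 ▸ (Ring.choose a i).2
  have h4 := PadicInt.isUnit_den _ h3
  rw [mem_pIntegers_iff]
  intro hdvd
  rw [PadicInt.isUnit_iff] at h4
  have h5 := (PadicInt.norm_lt_one_iff_dvd (p := p) ((Ring.choose α i).den : ℤ_[p])).2
    (by exact_mod_cast (Nat.cast_dvd_cast hdvd : (p : ℤ_[p]) ∣ _))
  exact absurd h4 h5.ne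

theorem cast_mul_of_mem_pIntegers [CharP F p] {a b : ℚ} (ha : a ∈ pIntegers p)
    (hb : b ∈ pIntegers p) : ((a * b : ℚ) : F) = a * b :=
  Rat.cast_mul_of_ne_zero (den_ne_zero_of_mem_pIntegers ha) (den_ne_zero_of_mem_pIntegers hb)

theorem cast_sum_of_mem_pIntegers [CharP F p] {ι : Type*} (s : Finset ι) (f : ι → ℚ)
    (h : ∀ i ∈ s, f i ∈ pIntegers p) : ((∑ i ∈ s, f i : ℚ) : F) = ∑ i ∈ s, (f i : F) := by
  classical
  induction s using Finset.induction_on with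
  | empty => simp
  | insert i s hi ih =>
    rw [Finset.sum_insert hi, Finset.sum_insert hi, Rat.cast_add_of_ne_zero, ih]
    · exact fun j hj => h j (Finset.mem_insert_of_mem hj)
    · exact den_ne_zero_of_mem_pIntegers (h i (Finset.mem_insert_self i s))
    · exact den_ne_zero_of_mem_pIntegers
        (sum_mem fun j hj => h j (Finset.mem_insert_of_mem hj))

@[simp]
theorem binom_zero_right (α : ℚ) : binom F α 0 = 1 := by
  simp [binom]

theorem binom_zero_left (i : ℕ) : binom F 0 i = if i = 0 then 1 else 0 := by
  rw [binom, Ring.choose_zero_ite]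
  split_ifs <;> simp

theorem binom_intCast (m : ℤ) (i : ℕ) : binom F m i = ((Ring.choose m i : ℤ) : F) := by
  have h := Ring.map_choose (Int.castRingHom ℚ) m i
  simp only [eq_intCast] at h
  rw [binom, ← h, Rat.cast_intCast]

/-- The Chu-Vandermonde identity modulo `p`. -/
theorem binom_add [CharP F p] {α β : ℚ} (hα : α ∈ pIntegers p) (hβ : β ∈ pIntegers p) (n : ℕ) :
    binom F (α + β) n =
      ∑ ij ∈ Finset.HasAntidiagonal.antidiagonal n, binom F α ij.1 * binom F β ij.2 := by
  rw [binom, Ring.add_choose_eq n (Commute.all α β), cast_sum_of_mem_pIntegers (p := p)]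
  · exact Finset.sum_congr rfl fun ij _ => cast_mul_of_mem_pIntegers
      (choose_mem_pIntegers hα _) (choose_mem_pIntegers hβ _)
  · exact fun ij _ => mul_mem (choose_mem_pIntegers hα _) (choose_mem_pIntegers hβ _)

theorem binom_mul_choose [CharP F p] {α : ℚ} (hα : α ∈ pIntegers p) {i t : ℕ} (h : t ≤ i) :
    binom F α i * (i.choose t : F) = binom F α t * binom F (α - t) (i - t) := by
  have h1 := Ring.choose_smul_choose α h
  have h2 : α - t ∈ pIntegers p := sub_mem hα (natCast_mem _ t)
  rw [binom, binom, binom, ← cast_mul_of_mem_pIntegers (choose_mem_pIntegers hα _)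
    (choose_mem_pIntegers h2 _), ← h1, nsmul_eq_mul, cast_mul_of_mem_pIntegers (p := p)
    (natCast_mem _ _) (choose_mem_pIntegers hα _), Rat.cast_natCast, mul_comm]

/-- The coefficient form of the Leibniz rule for `∂ʲ/j!` applied to `(1 + z)^α z^m`. -/
theorem binom_mul_choose_add [CharP F p] {α : ℚ} (hα : α ∈ pIntegers p) (m : ℤ) (i j : ℕ) :
    binom F α i * ((Ring.choose (m + i) j : ℤ) : F) =
      ∑ st ∈ Finset.HasAntidiagonal.antidiagonal j, if st.2 ≤ i then
        ((Ring.choose m st.1 : ℤ) : F) * binom F α st.2 * binom F (α - st.2) (i - st.2) else 0 := by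
  rw [Ring.add_choose_eq j (Commute.all m (i : ℤ)), Int.cast_sum, Finset.mul_sum]
  refine Finset.sum_congr rfl fun st _ => ?_
  rw [Ring.choose_natCast, Int.cast_mul, Int.cast_natCast]
  split_ifs with h
  · rw [mul_assoc, ← binom_mul_choose hα h]
    ring
  · rw [Nat.choose_eq_zero_of_lt (not_le.1 h)]
    simp

end Binom

/-! ### Residues -/

namespace VertexSuperalgebra

open Filter

variable {F V : Type*} [Field F] [AddCommGroup V] [Module F V] (A : VertexSuperalgebra F V)

theorem res_eq_sum_of_le {u v : V} {N : ℤ} (hN : ∀ n : ℤ, N ≤ n → A.mode n u v = 0) (α : ℚ)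
    {m : ℤ} {K : ℕ} (hK : N + m ≤ K) :
    A.res α m u v = ∑ i ∈ Finset.range K, binom F α i • A.mode (i - m) u v := by
  rw [res_apply]
  refine finsum_eq_sum_of_support_subset _ fun i hi => ?_
  by_contra hlt
  simp only [Finset.coe_range, Set.mem_Iio, not_lt] at hlt
  exact hi (by simp only [hN (i - m) (by omega), smul_zero])

theorem eventually_res_eq_sum (α : ℚ) (m : ℤ) (u v : V) :
    ∀ᶠ K : ℕ in atTop,
      ∑ i ∈ Finset.range K, binom F α i • A.mode (i - m) u v = A.res α m u v := by
  obtain ⟨N, hN⟩ := A.truncation u v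
  filter_upwards [eventually_ge_atTop (N + m).toNat] with K hK
  exact (A.res_eq_sum_of_le hN α (by omega)).symm

theorem res_zero_left (m : ℤ) (u v : V) : A.res 0 m u v = A.mode (-m) u v := by
  obtain ⟨K, hK, h⟩ := ((eventually_gt_atTop 0).and (A.eventually_res_eq_sum 0 m u v)).exists
  rw [← h, Finset.sum_eq_single_of_mem 0 (Finset.mem_range.2 hK)]
  · simp
  · intro i _ hi
    rw [binom_zero_left, if_neg hi, zero_smul]

variable {p : ℕ} [Fact p.Prime] [CharP F p]

/-- Expanding the factor `(1 + z)^α` in the residue of `(1 + z)^(α + β) z^(-m) Y(u,z)v`. -/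
theorem eventually_sum_binom_res {α β : ℚ} (hα : α ∈ pIntegers p) (hβ : β ∈ pIntegers p) (m : ℤ)
    (u v : V) : ∀ᶠ K : ℕ in atTop,
      ∑ q ∈ Finset.range K, binom F α q • A.res β (m - q) u v = A.res (α + β) m u v := by
  obtain ⟨N, hN⟩ := A.truncation u v
  filter_upwards [eventually_ge_atTop (N + m).toNat] with K hK
  rw [A.res_eq_sum_of_le hN (α + β) (K := K) (by omega)]
  have h1 : ∀ e ∈ Finset.range K, binom F (α + β) e • A.mode (e - m) u v =
      ∑ q ∈ Finset.range (e + 1),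
        (fun q k : ℕ => (binom F α q * binom F β k) • A.mode (q + k - m) u v) q (e - q) := by
    intro e _
    rw [binom_add hα hβ, Finset.Nat.sum_antidiagonal_eq_sum_range_succ_mk, Finset.sum_smul]
    refine Finset.sum_congr rfl fun q hq => ?_
    have : q ≤ e := Nat.lt_succ_iff.1 (Finset.mem_range.1 hq)
    simp only
    congr 3
    push_cast [this]
    ring_nf
  rw [Finset.sum_congr rfl h1, Finset.sum_range_diag_flip K
    (fun q k : ℕ => (binom F α q * binom F β k) • A.mode (q + k - m) u v)]
  refine Finset.sum_congr rfl fun q hq => ?_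
  have hq' := Finset.mem_range.1 hq
  rw [A.res_eq_sum_of_le hN β (K := K - q) (by omega), Finset.smul_sum]
  refine Finset.sum_congr rfl fun k _ => ?_
  rw [smul_smul]
  congr 3
  ring_nf

theorem res_add_one {α : ℚ} (hα : α ∈ pIntegers p) (m : ℤ) (u v : V) :
    A.res (α + 1) m u v = A.res α m u v + A.res α (m - 1) u v := by
  obtain ⟨K, hK, h⟩ := ((eventually_ge_atTop 2).and
    (A.eventually_sum_binom_res (p := p) (one_mem _) hα m u v)).exists
  have h1 : ∀ q : ℕ, binom F 1 q = ((Nat.choose 1 q : ℕ) : F) := fun q => by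
    have := binom_intCast (F := F) 1 q
    rw [Int.cast_one] at this
    rw [this, ← Nat.cast_one (R := ℤ), Ring.choose_natCast, Int.cast_natCast]
  rw [add_comm α, ← h, ← Finset.sum_subset (Finset.range_subset_range.2 hK)]
  · simp [Finset.sum_range_succ, h1]
  · intro q _ hq
    rw [h1, Nat.choose_eq_zero_of_lt (by simpa using hq)]
    simp

end VertexSuperalgebra

/-! ### The Jacobi identity for residues -/

theorem Finset.sum_zsmul_eq_of_eq_sum {F V : Type*} [Field F] [AddCommGroup V] [Module F V]
    {J K : ℕ} {c : ℕ → ℤ} {b : ℕ → F} {X : ℕ → V} {x : ℕ → ℕ → V}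
    (h : ∀ j ∈ Finset.range J, ∑ k ∈ Finset.range K, b k • x k j = X j) :
    ∑ j ∈ Finset.range J, c j • X j =
      ∑ k ∈ Finset.range K, b k • ∑ j ∈ Finset.range J, c j • x k j := by
  simp only [Finset.smul_sum]
  rw [Finset.sum_comm]
  refine Finset.sum_congr rfl fun j hj => ?_
  rw [← h j hj, Finset.smul_sum]
  exact Finset.sum_congr rfl fun k _ => smul_comm _ _ _

namespace VertexSuperalgebra

open Filter

variable {F V : Type*} [Field F] [AddCommGroup V] [Module F V] (A : VertexSuperalgebra F V)

/-- The Jacobi identity with all sums cut off at a common bound `J`, which stays valid when the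
exponents `m` and `n` are raised. -/
theorem eventually_jacobi_range {a b : ZMod 2} {u v : V} (hu : u ∈ A.parity a)
    (hv : v ∈ A.parity b) (w : V) (l m n : ℤ) : ∀ᶠ J : ℕ in atTop, ∀ i k : ℕ,
      (∑ j ∈ Finset.range J, ((-1) ^ j * Ring.choose l j : ℤ) •
          A.mode (l + (m + i) - j) u (A.mode (n + k + j) v w)) -
        (-1 : ℤ) ^ (a.val * b.val) •
          (∑ j ∈ Finset.range J, ((l.negOnePow : ℤ) * (-1) ^ j * Ring.choose l j : ℤ) •
            A.mode (l + (n + k) - j) v (A.mode (m + i + j) u w)) =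
      ∑ j ∈ Finset.range J, (Ring.choose (m + i) j : ℤ) •
          A.mode (m + i + (n + k) - j) (A.mode (l + j) u v) w := by
  obtain ⟨N₁, h₁⟩ := A.truncation v w
  obtain ⟨N₂, h₂⟩ := A.truncation u w
  obtain ⟨N₃, h₃⟩ := A.truncation u v
  filter_upwards [eventually_ge_atTop (N₁ - n).toNat, eventually_ge_atTop (N₂ - m).toNat,
    eventually_ge_atTop (N₃ - l).toNat] with J hJ₁ hJ₂ hJ₃ i k
  have cut : ∀ f : ℕ → V, (∀ j, J ≤ j → f j = 0) →
      ∑ᶠ j, f j = ∑ j ∈ Finset.range J, f j := fun f hf =>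
    finsum_eq_sum_of_support_subset _ fun j hj => by
      by_contra hlt
      exact hj (hf j (by simpa using hlt))
  have key := A.jacobi a b u hu v hv w l (m + i) (n + k)
  simp only [← mode_apply] at key
  rwa [cut _ fun j hj => by rw [h₁ _ (by omega), map_zero, smul_zero],
    cut _ fun j hj => by rw [h₂ _ (by omega), map_zero, smul_zero],
    cut _ fun j hj => by rw [h₃ _ (by omega), map_zero, LinearMap.zero_apply, smul_zero]] at key

/-- The Jacobi identity multiplied by `(1 + z)^β` in the variable of `Y(v,z)`. -/
theorem eventually_jacobi_res {a b : ZMod 2} {u v : V} (hu : u ∈ A.parity a)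
    (hv : v ∈ A.parity b) (w : V) (β : ℚ) (l m n : ℤ) : ∀ᶠ J : ℕ in atTop, ∀ i : ℕ,
      (∑ j ∈ Finset.range J, ((-1) ^ j * Ring.choose l j : ℤ) •
          A.mode (l + (m + i) - j) u (A.res β (-(n + j)) v w)) -
        (-1 : ℤ) ^ (a.val * b.val) •
          (∑ j ∈ Finset.range J, ((l.negOnePow : ℤ) * (-1) ^ j * Ring.choose l j : ℤ) •
            A.res β (-(l + n - j)) v (A.mode (m + i + j) u w)) =
      ∑ j ∈ Finset.range J, (Ring.choose (m + i) j : ℤ) •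
          A.res β (-(m + i + n - j)) (A.mode (l + j) u v) w := by
  filter_upwards [A.eventually_jacobi_range hu hv w l m n] with J hJ i
  obtain ⟨K, e₁, e₂, e₃⟩ := (((Finset.range J).eventually_all.2 fun j _ =>
      A.eventually_res_eq_sum β (-(n + j)) v w).and
    (((Finset.range J).eventually_all.2 fun j _ =>
      A.eventually_res_eq_sum β (-(l + n - j)) v (A.mode (m + i + j) u w)).and
    ((Finset.range J).eventually_all.2 fun j _ =>
      A.eventually_res_eq_sum β (-(m + i + n - j)) (A.mode (l + j) u v) w))).exists
  rw [Finset.sum_zsmul_eq_of_eq_sum (b := binom F β) (K := K)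
      (x := fun k j => A.mode (l + (m + i) - j) u (A.mode (n + k + j) v w)),
    Finset.sum_zsmul_eq_of_eq_sum (b := binom F β) (K := K)
      (x := fun k j => A.mode (l + (n + k) - j) v (A.mode (m + i + j) u w)),
    Finset.sum_zsmul_eq_of_eq_sum (b := binom F β) (K := K)
      (x := fun k j => A.mode (m + i + (n + k) - j) (A.mode (l + j) u v) w),
    Finset.smul_sum, ← Finset.sum_sub_distrib]
  · refine Finset.sum_congr rfl fun k _ => ?_
    rw [← hJ i k, smul_sub, smul_comm (binom F β k)]
  · intro j hj
    rw [← e₃ j hj]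
    exact Finset.sum_congr rfl fun k _ => by ring_nf
  · intro j hj
    rw [← e₂ j hj]
    exact Finset.sum_congr rfl fun k _ => by ring_nf
  · intro j hj
    rw [← e₁ j hj, map_sum]
    exact Finset.sum_congr rfl fun k _ => by rw [map_smul]; ring_nf

variable {p : ℕ} [Fact p.Prime] [CharP F p]

/-- The coefficient of `z₀^j` in the expansion of `(1 + z)^α z^m` at `z = w + z₀`, multiplied by
`(1 + w)^β w^n`. -/
theorem eventually_sum_binom_choose_res {α β : ℚ} (hα : α ∈ pIntegers p) (hβ : β ∈ pIntegers p)
    (m n : ℤ) (j : ℕ) (u v : V) : ∀ᶠ K : ℕ in atTop,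
      ∑ i ∈ Finset.range K, binom F α i • (Ring.choose (m + i) j : ℤ) •
        A.res β (-(m + i + n - j)) u v =
      ∑ st ∈ Finset.HasAntidiagonal.antidiagonal j,
        (((Ring.choose m st.1 : ℤ) : F) * binom F α st.2) •
          A.res (α + β - st.2) (-(m + n - st.1)) u v := by
  have h1 : ∀ st ∈ Finset.HasAntidiagonal.antidiagonal j, ∀ᶠ K : ℕ in atTop,
      ∑ q ∈ Finset.range (K - st.2), binom F (α - st.2) q • A.res β (-(m + n - st.1) - q) u v =
        A.res (α - st.2 + β) (-(m + n - st.1)) u v := fun st _ =>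
    (tendsto_sub_atTop_nat st.2).eventually
      (A.eventually_sum_binom_res (sub_mem hα (natCast_mem _ st.2)) hβ _ u v)
  filter_upwards [(Finset.HasAntidiagonal.antidiagonal j).eventually_all.2 h1,
    eventually_ge_atTop j] with K hK hjK
  have h2 : ∀ i : ℕ, binom F α i • (Ring.choose (m + i) j : ℤ) •
        A.res β (-(m + i + n - j)) u v =
      ∑ st ∈ Finset.HasAntidiagonal.antidiagonal j, if st.2 ≤ i then
        (((Ring.choose m st.1 : ℤ) : F) * binom F α st.2) • binom F (α - st.2) (i - st.2) •
          A.res β (-(m + i + n - j)) u v else 0 := by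
    intro i
    rw [← Int.cast_smul_eq_zsmul F, smul_smul, binom_mul_choose_add hα, Finset.sum_smul]
    refine Finset.sum_congr rfl fun st _ => ?_
    split_ifs
    · rw [smul_smul]
    · rw [zero_smul]
  simp only [h2]
  rw [Finset.sum_comm]
  refine Finset.sum_congr rfl fun st hst => ?_
  have hst' : st.1 + st.2 = j := Finset.HasAntidiagonal.mem_antidiagonal.1 hst
  rw [show α + β - st.2 = α - st.2 + β by ring, ← hK st hst, Finset.smul_sum,
    ← Finset.sum_range_add_sum_Ico _ (show st.2 ≤ K by omega), Finset.sum_eq_zero, zero_add,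
    Finset.sum_Ico_eq_sum_range]
  · refine Finset.sum_congr rfl fun q _ => ?_
    rw [if_pos (Nat.le_add_right _ _), Nat.add_sub_cancel_left]
    congr 4
    push_cast [← hst']
    ring_nf
  · intro i hi
    exact if_neg (not_le.2 (Finset.mem_range.1 hi))

/-- The Jacobi identity multiplied by `(1 + z)^α` in the variable of `Y(u,z)` and by `(1 + w)^β` in
the variable of `Y(v,w)`: this compares the expansions of the residue of
`(1 + z)^α z^m (1 + w)^β w^n (z - w)^l` in the three domains `|z| > |w|`, `|w| > |z|`
and `|w| > |z - w|`. -/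
theorem eventually_jacobi_res_res {a b : ZMod 2} {u v : V} (hu : u ∈ A.parity a)
    (hv : v ∈ A.parity b) (w : V) {α β : ℚ} (hα : α ∈ pIntegers p) (hβ : β ∈ pIntegers p)
    (l m n : ℤ) : ∀ᶠ J : ℕ in atTop,
      (∑ j ∈ Finset.range J, ((-1) ^ j * Ring.choose l j : ℤ) •
          A.res α (-(l + m - j)) u (A.res β (-(n + j)) v w)) -
        (-1 : ℤ) ^ (a.val * b.val) •
          (∑ j ∈ Finset.range J, ((l.negOnePow : ℤ) * (-1) ^ j * Ring.choose l j : ℤ) •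
            A.res β (-(l + n - j)) v (A.res α (-(m + j)) u w)) =
      ∑ j ∈ Finset.range J, ∑ st ∈ Finset.HasAntidiagonal.antidiagonal j,
        (((Ring.choose m st.1 : ℤ) : F) * binom F α st.2) •
          A.res (α + β - st.2) (-(m + n - st.1)) (A.mode (l + j) u v) w := by
  filter_upwards [A.eventually_jacobi_res hu hv w β l m n] with J hJ
  obtain ⟨K, e₁, e₂, e₃⟩ := (((Finset.range J).eventually_all.2 fun j _ =>
      A.eventually_res_eq_sum α (-(l + m - j)) u (A.res β (-(n + j)) v w)).and
    (((Finset.range J).eventually_all.2 fun j _ =>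
      A.eventually_res_eq_sum α (-(m + j)) u w).and
    ((Finset.range J).eventually_all.2 fun j _ =>
      A.eventually_sum_binom_choose_res hα hβ m n j (A.mode (l + j) u v) w))).exists
  rw [Finset.sum_zsmul_eq_of_eq_sum (b := binom F α) (K := K)
      (x := fun i j => A.mode (l + (m + i) - j) u (A.res β (-(n + j)) v w)),
    Finset.sum_zsmul_eq_of_eq_sum (b := binom F α) (K := K)
      (x := fun i j => A.res β (-(l + n - j)) v (A.mode (m + i + j) u w)),
    Finset.smul_sum, ← Finset.sum_sub_distrib, ← Finset.sum_congr rfl e₃, Finset.sum_comm]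
  · refine Finset.sum_congr rfl fun i _ => ?_
    rw [← Finset.smul_sum, ← hJ i, smul_sub, smul_comm (binom F α i)]
  · intro j hj
    rw [← e₂ j hj, map_sum]
    exact Finset.sum_congr rfl fun k _ => by rw [map_smul]; ring_nf
  · intro j hj
    rw [← e₁ j hj]
    exact Finset.sum_congr rfl fun k _ => by ring_nf

end VertexSuperalgebra

/-! ### The automorphism `g σ` -/

namespace VertexSuperalgebra

variable {F V : Type*} [Field F] [AddCommGroup V] [Module F V] (A : VertexSuperalgebra F V)

theorem parity_induction {P : V → Prop} (hadd : ∀ u v, P u → P v → P (u + v))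
    (h : ∀ a, ∀ u ∈ A.parity a, P u) (u : V) : P u := by
  have hu : u ∈ ⨆ a, A.parity a := by
    rw [A.parity_isInternal.submodule_iSup_eq_top]; trivial
  exact Submodule.iSup_induction A.parity (motive := P) hu h (h 0 0 (zero_mem _)) hadd

theorem sigma_of_mem_parity {a : ZMod 2} {u : V} (hu : u ∈ A.parity a) :
    A.sigma u = (-1 : ℤ) ^ a.val • u := by
  change componentMap A.parity_isInternal 0 u - componentMap A.parity_isInternal 1 u = _
  fin_cases a
  · have h0 : u ∈ A.parity 0 := hu
    rw [componentMap_same _ h0, componentMap_of_ne _ one_ne_zero h0]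
    change u - 0 = (-1 : ℤ) ^ 0 • u
    simp
  · have h1 : u ∈ A.parity 1 := hu
    rw [componentMap_same _ h1, componentMap_of_ne _ zero_ne_one h1]
    change 0 - u = (-1 : ℤ) ^ 1 • u
    simp

theorem sigma_mul_self : A.sigma * A.sigma = 1 := by
  ext u
  induction u using A.parity_induction with
  | hadd u v hu hv => rw [map_add, map_add, hu, hv]
  | h a u hu =>
    rw [LinearEquiv.mul_apply, A.sigma_of_mem_parity hu, map_zsmul, A.sigma_of_mem_parity hu,
      smul_smul, ← mul_pow]
    simp

theorem isAutomorphism_sigma : A.IsAutomorphism A.sigma := by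
  refine ⟨by simp [A.sigma_of_mem_parity A.vac_mem_parity], fun u v n => ?_⟩
  induction u using A.parity_induction with
  | hadd u u' hu hu' => simp only [map_add, LinearMap.add_apply, hu, hu']
  | h a u hu =>
    induction v using A.parity_induction with
    | hadd v v' hv hv' => simp only [map_add, hv, hv']
    | h b v hv =>
      have sign : ∀ a b : ZMod 2, (-1 : ℤ) ^ (a + b).val = (-1) ^ b.val * (-1) ^ a.val := by
        decide
      rw [A.sigma_of_mem_parity hu, A.sigma_of_mem_parity hv,
        A.sigma_of_mem_parity (u := A.mode n u v) (A.parity_ncoeff a b u hu v hv n), sign]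
      simp only [map_zsmul, LinearMap.smul_apply, smul_smul]

theorem IsAutomorphism.mul {A : VertexSuperalgebra F V} {g h : V ≃ₗ[F] V}
    (hg : A.IsAutomorphism g) (hh : A.IsAutomorphism h) : A.IsAutomorphism (g * h) :=
  ⟨by rw [LinearEquiv.mul_apply, hh.1, hg.1], fun u v n => by
    simp only [LinearEquiv.mul_apply, hh.2, hg.2]⟩

theorem mem_starSpace_iff {g : V ≃ₗ[F] V} {ε : F} {r : ℕ} {u : V} :
    u ∈ A.starSpace g ε r ↔ (g * A.sigma : V ≃ₗ[F] V) u = ε ^ r • u :=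
  Module.End.mem_eigenspace_iff

theorem starSpace_mod {g : V ≃ₗ[F] V} {ε : F} (hε : IsPrimitiveRoot ε (A.T₀ g)) (r : ℕ) :
    A.starSpace g ε (r % A.T₀ g) = A.starSpace g ε r := by
  rw [starSpace, starSpace, hε.eq_orderOf, pow_mod_orderOf]

theorem mode_mem_starSpace {g : V ≃ₗ[F] V} (hg : A.IsAutomorphism g) {ε : F} {r s : ℕ} {u v : V}
    (hu : u ∈ A.starSpace g ε r) (hv : v ∈ A.starSpace g ε s) (n : ℤ) :
    A.mode n u v ∈ A.starSpace g ε (r + s) := by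
  rw [mem_starSpace_iff] at hu hv ⊢
  rw [(hg.mul A.isAutomorphism_sigma).2, hu, hv, map_smul, map_smul, LinearMap.smul_apply,
    smul_smul, mul_comm, pow_add]

theorem vac_mem_starSpace {g : V ≃ₗ[F] V} (hg : A.IsAutomorphism g) (ε : F) :
    A.vac ∈ A.starSpace g ε 0 := by
  rw [mem_starSpace_iff, pow_zero, one_smul]
  exact (hg.mul A.isAutomorphism_sigma).1

theorem starProj_mem_of_stable {g : V ≃ₗ[F] V} {S : Submodule F V}
    (hS : ∀ v ∈ S, (g * A.sigma : V ≃ₗ[F] V) v ∈ S) (ε : F) (r : ℕ) {v : V} (hv : v ∈ S) :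
    A.starProj g ε r v ∈ S := by
  have hpow : ∀ j : ℕ, ((g * A.sigma) ^ j : V ≃ₗ[F] V) v ∈ S := fun j => by
    induction j with
    | zero => simpa using hv
    | succ j ih =>
      rw [pow_succ', LinearEquiv.mul_apply]
      exact hS _ ih
  simp only [starProj, LinearMap.smul_apply, LinearMap.sum_apply]
  exact S.smul_mem _ (S.sum_mem fun j _ => S.smul_mem _ (hpow j))

theorem starProj_mem {g : V ≃ₗ[F] V} {ε : F} (hε : IsPrimitiveRoot ε (A.T₀ g))
    (hT : (A.T₀ g : F) ≠ 0) (r : ℕ) (v : V) : A.starProj g ε r v ∈ A.starSpace g ε r := by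
  have hpos : A.T₀ g ≠ 0 := fun h => hT (by simp [h])
  have hε0 : ε ≠ 0 := hε.ne_zero hpos
  set f : ℕ → V := fun j => ((ε ^ (r * j))⁻¹ : F) • ((g * A.sigma) ^ j : V ≃ₗ[F] V) v with hf
  have hsum : A.starProj g ε r v = (A.T₀ g : F)⁻¹ • ∑ j ∈ Finset.range (A.T₀ g), f j := by
    simp [starProj, hf, LinearMap.sum_apply]
  -- `g σ` shifts the summands cyclically, up to the factor `ε ^ r`
  have hstep : ∀ j, (g * A.sigma : V ≃ₗ[F] V) (f j) = ε ^ r • f (j + 1) := fun j => by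
    simp only [hf]
    rw [map_smul, smul_smul, pow_succ' (g * A.sigma), LinearEquiv.mul_apply (g * A.sigma)]
    congr 1
    rw [mul_add, mul_one, pow_add]
    field_simp
  have hlast : f (A.T₀ g) = f 0 := by
    simp only [hf]
    rw [mul_comm, pow_mul, hε.pow_eq_one, T₀, pow_orderOf_eq_one]
    simp
  rw [mem_starSpace_iff, hsum, map_smul, map_sum, Finset.sum_congr rfl fun j _ => hstep j,
    ← Finset.smul_sum, smul_comm]
  congr 2
  have h1 := Finset.sum_range_succ f (A.T₀ g)
  rw [Finset.sum_range_succ', hlast] at h1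
  exact add_right_cancel h1

theorem sum_starProj {g : V ≃ₗ[F] V} {ε : F} (hε : IsPrimitiveRoot ε (A.T₀ g))
    (hT : (A.T₀ g : F) ≠ 0) (v : V) : ∑ r ∈ Finset.range (A.T₀ g), A.starProj g ε r v = v := by
  have hpos : 0 < A.T₀ g := Nat.pos_of_ne_zero fun h => hT (by simp [h])
  have hε0 : ε ≠ 0 := hε.ne_zero hpos.ne'
  simp only [starProj, LinearMap.smul_apply, LinearMap.sum_apply, LinearEquiv.coe_coe]
  rw [← Finset.smul_sum, Finset.sum_comm]
  simp only [← Finset.sum_smul]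
  rw [Finset.sum_eq_single_of_mem 0 (Finset.mem_range.2 hpos)]
  · simp [smul_smul, hT]
  · intro j hj hj0
    have hne : (ε ^ j)⁻¹ ≠ 1 := fun h =>
      hε.pow_ne_one_of_pos_of_lt hj0 (Finset.mem_range.1 hj) (inv_eq_one.1 h)
    have hgeom : ∑ r ∈ Finset.range (A.T₀ g), (ε ^ (r * j))⁻¹ = 0 := by
      simp_rw [mul_comm _ j, pow_mul, ← inv_pow]
      rw [inv_pow, geom_sum_eq (by simpa using hne)]
      simp [← pow_mul, mul_comm j, pow_mul ε, hε.pow_eq_one]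
    rw [hgeom, zero_smul]

end VertexSuperalgebra

namespace HalfGradedVertexSuperalgebra

variable {F V : Type*} [Field F] [AddCommGroup V] [Module F V]
  (A : HalfGradedVertexSuperalgebra F V)

theorem mem_parity_of_mem_halfDeg {k : ℤ} {u : V} (hu : u ∈ A.halfDeg k) :
    u ∈ A.parity (k : ZMod 2) := by
  obtain ⟨n, rfl | rfl⟩ := Int.even_or_odd' k
  · have h : ((2 * n : ℤ) : ZMod 2) = 0 := by
      push_cast
      rw [show (2 : ZMod 2) = 0 from rfl, zero_mul]
    rw [h, A.parity_zero_eq]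
    exact le_iSup (fun n : ℤ => A.halfDeg (2 * n)) n hu
  · have h : ((2 * n + 1 : ℤ) : ZMod 2) = 1 := by
      push_cast
      rw [show (2 : ZMod 2) = 0 from rfl, zero_mul, zero_add]
    rw [h, A.parity_one_eq]
    exact le_iSup (fun n : ℤ => A.halfDeg (2 * n + 1)) n hu

theorem halfDeg_induction_of_mem_parity {P : V → Prop} (hadd : ∀ u v, P u → P v → P (u + v))
    {a : ZMod 2} (h : ∀ k : ℤ, (k : ZMod 2) = a → ∀ u ∈ A.halfDeg k, P u) {u : V}
    (hu : u ∈ A.parity a) : P u := by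
  fin_cases a
  · have h0 : u ∈ A.parity 0 := hu
    rw [A.parity_zero_eq] at h0
    have hk : ∀ n : ℤ, ((2 * n : ℤ) : ZMod 2) = 0 := fun n => by
      push_cast
      rw [show (2 : ZMod 2) = 0 from rfl, zero_mul]
    exact Submodule.iSup_induction _ (motive := P) h0 (fun n => h _ (hk n))
      (h _ (hk 0) 0 (zero_mem _)) hadd
  · have h1 : u ∈ A.parity 1 := hu
    rw [A.parity_one_eq] at h1
    have hk : ∀ n : ℤ, ((2 * n + 1 : ℤ) : ZMod 2) = 1 := fun n => by
      push_cast
      rw [show (2 : ZMod 2) = 0 from rfl, zero_mul, zero_add]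
    exact Submodule.iSup_induction _ (motive := P) h1 (fun n => h _ (hk n))
      (h _ (hk 0) 0 (zero_mem _)) hadd

variable {g : V ≃ₗ[F] V} (hgdeg : ∀ (k : ℤ), ∀ v ∈ A.halfDeg k, g v ∈ A.halfDeg k)
include hgdeg

theorem mul_sigma_mem_halfDeg (k : ℤ) (v : V) (hv : v ∈ A.halfDeg k) :
    (g * A.sigma : V ≃ₗ[F] V) v ∈ A.halfDeg k := by
  rw [LinearEquiv.mul_apply, A.sigma_of_mem_parity (A.mem_parity_of_mem_halfDeg hv), map_zsmul]
  exact zsmul_mem (hgdeg k v hv) _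

theorem mul_sigma_mem_parity (a : ZMod 2) (v : V) (hv : v ∈ A.parity a) :
    (g * A.sigma : V ≃ₗ[F] V) v ∈ A.parity a :=
  A.halfDeg_induction_of_mem_parity
    (P := fun v => (g * A.sigma : V ≃ₗ[F] V) v ∈ A.parity a)
    (fun u v hu hv => by rw [map_add]; exact add_mem hu hv)
    (fun k hk u hu => by
      rw [← hk]
      exact A.mem_parity_of_mem_halfDeg (A.mul_sigma_mem_halfDeg hgdeg k u hu)) hv

theorem commute_sigma : Commute g A.sigma := by
  ext u
  induction u using A.parity_induction with
  | hadd u v hu hv => rw [map_add, map_add, hu, hv]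
  | h a u hu =>
    have hgu : g u ∈ A.parity a := by
      have := A.mul_sigma_mem_parity hgdeg a _ (zsmul_mem hu ((-1) ^ a.val))
      rwa [LinearEquiv.mul_apply, map_zsmul, A.sigma_of_mem_parity hu, smul_smul, ← mul_pow,
        neg_one_mul, neg_neg, one_pow, one_smul] at this
    rw [LinearEquiv.mul_apply, LinearEquiv.mul_apply, A.sigma_of_mem_parity hu, map_zsmul,
      A.sigma_of_mem_parity hgu]

/-- The order of `g σ` is prime to `p`, since it divides twice the order of `g`. -/
theorem T₀_cast_ne_zero {p : ℕ} [CharP F p] (hp : p.Prime) (hp2 : 2 < p)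
    (hT : (orderOf g).Coprime p) : (A.T₀ g : F) ≠ 0 := by
  rw [Ne, CharP.cast_eq_zero_iff F p]
  intro hdvd
  have h1 : A.T₀ g ∣ 2 * orderOf g := by
    refine orderOf_dvd_of_pow_eq_one ?_
    rw [(A.commute_sigma hgdeg).mul_pow, mul_comm, pow_mul, pow_orderOf_eq_one, one_pow,
      mul_comm, pow_mul, sq A.sigma, A.sigma_mul_self, one_pow, one_mul]
  rcases hp.dvd_mul.1 (hdvd.trans h1) with h | h
  · exact absurd (Nat.le_of_dvd two_pos h) (by omega)
  · exact hp.coprime_iff_not_dvd.1 hT.symm h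

/-- `V` is spanned by the vectors that are homogeneous for both the degree and the
eigenspace decomposition of `g σ`. -/
theorem bihomogeneous_induction {ε : F} (hε : IsPrimitiveRoot ε (A.T₀ g))
    (hT : (A.T₀ g : F) ≠ 0) {P : V → Prop} (hadd : ∀ u v, P u → P v → P (u + v))
    (h : ∀ (k : ℤ) (r : ℕ), r < A.T₀ g → ∀ u ∈ A.halfDeg k, u ∈ A.starSpace g ε r → P u)
    (u : V) : P u := by
  have h0 : P 0 := h 0 0 (Nat.pos_of_ne_zero fun h => hT (by simp [h])) 0 (zero_mem _) (zero_mem _)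
  have hu : u ∈ ⨆ k, A.halfDeg k := by
    rw [A.halfDeg_isInternal.submodule_iSup_eq_top]; trivial
  refine Submodule.iSup_induction A.halfDeg (motive := P) hu (fun k u hu => ?_) h0 hadd
  rw [← A.sum_starProj hε hT u]
  exact Finset.sum_induction _ P hadd h0 fun r hr => h k r (Finset.mem_range.1 hr) _
    (A.starProj_mem_of_stable (A.mul_sigma_mem_halfDeg hgdeg k) ε r hu)
    (A.starProj_mem hε hT r u)

end HalfGradedVertexSuperalgebra

/-! ### Products and the subspace `O_g(V)` on homogeneous vectors -/

/-- The exponent of `1 + z` in `u ∘_g^n v`, for `u` of degree `k / 2` in `V^{r*}`. -/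
noncomputable def twistExp (T : ℕ) (k : ℤ) (r : ℕ) : ℚ :=
  if r = 0 then (k : ℚ) / 2 else (k : ℚ) / 2 - 1 + (r : ℚ) / (T : ℚ)

/-- The order of the pole at `z = 0` in `u ∘_g^0 v`, for `u ∈ V^{r*}`. -/
def twistPole (r : ℕ) : ℤ := if r = 0 then 2 else 1

theorem twistExp_zero (T : ℕ) (k : ℤ) : twistExp T k 0 = (k : ℚ) / 2 := if_pos rfl

theorem twistExp_add (T : ℕ) (k k' : ℤ) (r : ℕ) :
    twistExp T (k + k') r = (k : ℚ) / 2 + twistExp T k' r := by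
  unfold twistExp
  split_ifs <;> push_cast <;> ring

theorem twistExp_mem_pIntegers {F : Type*} [Field F] {p : ℕ} [Fact p.Prime] [CharP F p]
    (h2 : (2 : F) ≠ 0) {T : ℕ} (hT : (T : F) ≠ 0) (k : ℤ) (r : ℕ) :
    twistExp T k r ∈ pIntegers p := by
  have hk : (k : ℚ) / 2 ∈ pIntegers p := by
    simpa using intCast_div_natCast_mem_pIntegers (F := F) (p := p) k (n := 2) (by simpa using h2)
  have hr : (r : ℚ) / T ∈ pIntegers p := by
    simpa using intCast_div_natCast_mem_pIntegers (F := F) (p := p) r hT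
  unfold twistExp
  split_ifs
  · exact hk
  · exact add_mem (sub_mem hk (one_mem _)) hr

namespace HalfGradedVertexSuperalgebra

open Filter

variable {F V : Type*} [Field F] [AddCommGroup V] [Module F V]
  (A : HalfGradedVertexSuperalgebra F V) {g : V ≃ₗ[F] V} {ε : F}

section

variable (hε : IsPrimitiveRoot ε (A.T₀ g)) (hT : (A.T₀ g : F) ≠ 0)
include hε hT

theorem circ_eq_res (n : ℕ) {k : ℤ} {r : ℕ} (hr : r < A.T₀ g) {u : V} (hu : u ∈ A.halfDeg k)
    (hu' : u ∈ A.starSpace g ε r) (v : V) :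
    A.circ g ε n u v = A.res (twistExp (A.T₀ g) k r) (twistPole r + n) u v := by
  rcases eq_or_ne r 0 with rfl | h
  · exact A.circ_of_mem_zero g hε hT n hu hu' v
  · rw [A.circ_of_mem_ne_zero g hε hT n h hr hu hu' v, twistExp, twistPole, if_neg h, if_neg h]

theorem star_eq_res {k : ℤ} {u : V} (hu : u ∈ A.halfDeg k) (hu' : u ∈ A.starSpace g ε 0) (v : V) :
    A.star g ε u v = A.res ((k : ℚ) / 2) 1 u v := by
  rw [A.star_of_mem g hε hT (Nat.pos_of_ne_zero fun h => hT (by simp [h])) hu hu' v, if_pos rfl]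

theorem star_eq_zero {k : ℤ} {r : ℕ} (hr : r % A.T₀ g ≠ 0) {u : V} (hu : u ∈ A.halfDeg k)
    (hu' : u ∈ A.starSpace g ε r) (v : V) : A.star g ε u v = 0 := by
  rw [← A.starSpace_mod hε] at hu'
  rw [A.star_of_mem g hε hT (Nat.mod_lt _ (Nat.pos_of_ne_zero fun h => hT (by simp [h])))
    hu hu' v, if_neg hr]

end

theorem circ_mem_O (n : ℕ) (u v : V) : A.circ g ε n u v ∈ A.O g ε :=
  Submodule.subset_span ⟨n, u, v, rfl⟩

theorem mode_mem_halfDeg {k k' : ℤ} {u v : V} (hu : u ∈ A.halfDeg k) (hv : v ∈ A.halfDeg k')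
    (n : ℤ) : A.mode n u v ∈ A.halfDeg (k + k' + 2 * (-n - 1)) := by
  have := A.halfDeg_ncoeff k k' u hu v hv n
  rwa [show k + k' - 2 * n - 2 = k + k' + 2 * (-n - 1) by ring] at this

variable (p : ℕ) [Fact p.Prime] [CharP F p]
variable (h2 : (2 : F) ≠ 0) (hε : IsPrimitiveRoot ε (A.T₀ g)) (hT : (A.T₀ g : F) ≠ 0)
include p h2 hε hT

/-- Zhu's lemma: the exponent of `1 + z` in a generator of `O_g(V)` may be raised by `s` if the
order of the pole is raised by at least `s`. -/
theorem res_mem_O {k : ℤ} {r : ℕ} (hr : r < A.T₀ g) {u : V} (hu : u ∈ A.halfDeg k)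
    (hu' : u ∈ A.starSpace g ε r) (v : V) {s n : ℕ} (hsn : s ≤ n) :
    A.res (twistExp (A.T₀ g) k r + s) (twistPole r + n) u v ∈ A.O g ε := by
  induction s generalizing n with
  | zero =>
    rw [Nat.cast_zero, add_zero, ← A.circ_eq_res hε hT n hr hu hu']
    exact A.circ_mem_O n u v
  | succ s ih =>
    obtain ⟨n, rfl⟩ : ∃ n', n = n' + 1 := ⟨n - 1, by omega⟩
    have hmem := twistExp_mem_pIntegers (p := p) h2 hT k r
    rw [Nat.cast_succ, ← add_assoc, A.res_add_one (p := p) (add_mem hmem (natCast_mem _ s)),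
      show twistPole r + ((n + 1 : ℕ) : ℤ) - 1 = twistPole r + n by push_cast; ring]
    exact add_mem (ih (by omega)) (ih (by omega))

variable (hg : A.IsAutomorphism g)
include hg

/-- `a *_g (u ∘_g^n w) ∈ O_g(V)`: up to `±u ∘_g^n (a *_g w) ∈ O_g(V)` it is the commutator of two
residues, which is expanded by the Jacobi identity with `l = 0` and `m = -1`. -/
theorem star_circ_mem_O {k k' : ℤ} {r : ℕ} (hr : r < A.T₀ g) {a u : V} (ha : a ∈ A.halfDeg k)
    (ha' : a ∈ A.starSpace g ε 0) (hu : u ∈ A.halfDeg k') (hu' : u ∈ A.starSpace g ε r) (n : ℕ)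
    (w : V) : A.star g ε a (A.circ g ε n u w) ∈ A.O g ε := by
  have hk := twistExp_mem_pIntegers (p := p) h2 hT k 0
  have hk' := twistExp_mem_pIntegers (p := p) h2 hT k' r
  rw [twistExp_zero] at hk
  obtain ⟨J, hJ, key⟩ := ((eventually_gt_atTop 0).and
    (A.eventually_jacobi_res_res (A.mem_parity_of_mem_halfDeg ha)
      (A.mem_parity_of_mem_halfDeg hu) w hk hk' 0 (-1) (-(twistPole r + n)))).exists
  -- for `l = 0` only the terms with `j = 0` survive on the commutator side
  have hl : ∀ (x : ℤ) (f : ℕ → V), ∑ j ∈ Finset.range J, (x * (-1) ^ j *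
      Ring.choose (0 : ℤ) j : ℤ) • f j = x • f 0 := fun x f => by
    rw [Finset.sum_eq_single_of_mem 0 (Finset.mem_range.2 hJ)]
    · simp
    · intro j _ hj
      rw [Ring.choose_zero_pos ℤ (Nat.pos_of_ne_zero hj), mul_zero, zero_smul]
  have hl' := hl 1
  simp only [one_mul, one_smul] at hl'
  rw [hl, hl'] at key
  simp only [Nat.cast_zero, sub_zero, add_zero, zero_add, neg_neg, Int.negOnePow_zero,
    Units.val_one, one_smul] at key
  rw [← A.circ_eq_res hε hT n hr hu hu', ← A.circ_eq_res hε hT n hr hu hu',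
    sub_eq_iff_eq_add] at key
  rw [A.star_eq_res hε hT ha ha', key]
  refine add_mem (sum_mem fun j _ => sum_mem fun st hst => Submodule.smul_mem _ _ ?_)
    (zsmul_mem (A.circ_mem_O n u _) _)
  have hst' : st.1 + st.2 = j := Finset.HasAntidiagonal.mem_antidiagonal.1 hst
  -- `a_j u` has degree `deg a + deg u - j - 1`, so the exponent of `1 + w` exceeds that of a
  -- generator by `j + 1 - st.2 = st.1 + 1`
  have hmem := A.res_mem_O p h2 hε hT hr (A.mode_mem_halfDeg ha hu j)
    (by simpa using A.mode_mem_starSpace hg ha' hu' j) w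
    (s := st.1 + 1) (n := n + 1 + st.1) (by omega)
  convert hmem using 4
  · rw [add_comm (k + k'), twistExp_add, twistExp_add, ← hst']
    push_cast
    ring
  · push_cast
    ring

/-- The iterate formula: the Jacobi identity with `m = 0` and `n = -1`. -/
theorem eventually_star_res {k k' : ℤ} {r s : ℕ} (hrs : (r + s) % A.T₀ g = 0) {u v : V}
    (hu : u ∈ A.halfDeg k) (hu' : u ∈ A.starSpace g ε r) (hv : v ∈ A.halfDeg k')
    (hv' : v ∈ A.starSpace g ε s) (w : V) {α β : ℚ} (hα : α ∈ pIntegers p) (M : ℤ)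
    (hβ : α + β = ((k + k' : ℤ) : ℚ) / 2 + M - 1) : ∀ᶠ J : ℕ in atTop,
      A.star g ε (A.res α M u v) w =
        (∑ j ∈ Finset.range J, ((-1) ^ j * Ring.choose (-M) j : ℤ) •
          A.res α (M + j) u (A.res β (1 - j) v w)) -
        (-1 : ℤ) ^ ((k : ZMod 2).val * (k' : ZMod 2).val) •
          (∑ j ∈ Finset.range J, (((-M).negOnePow : ℤ) * (-1) ^ j * Ring.choose (-M) j : ℤ) •
            A.res β (M + 1 + j) v (A.res α (-j) u w)) := by
  have hβ' : β ∈ pIntegers p := by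
    have hkk := twistExp_mem_pIntegers (p := p) h2 hT (k + k') 0
    rw [twistExp_zero] at hkk
    rw [show β = ((k + k' : ℤ) : ℚ) / 2 + M - 1 - α by rw [← hβ]; ring]
    exact sub_mem (sub_mem (add_mem hkk (intCast_mem _ M)) (one_mem _)) hα
  filter_upwards [A.eventually_res_eq_sum α M u v,
    A.eventually_jacobi_res_res (A.mem_parity_of_mem_halfDeg hu)
      (A.mem_parity_of_mem_halfDeg hv) w hα hβ' (-M) 0 (-1)] with J h₁ h₂
  have e₁ : ∀ j : ℕ, -(-M + 0 - j) = M + j := fun j => by ring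
  have e₂ : ∀ j : ℕ, -(-1 + (j : ℤ)) = 1 - j := fun j => by ring
  have e₃ : ∀ j : ℕ, -(-M + -1 - j) = M + 1 + j := fun j => by ring
  have e₄ : ∀ j : ℕ, -(0 + (j : ℤ)) = -j := fun j => by ring
  simp only [e₁, e₂, e₃, e₄] at h₂
  rw [h₂, ← h₁, map_sum, LinearMap.sum_apply]
  refine Finset.sum_congr rfl fun j _ => ?_
  rw [Finset.sum_eq_single_of_mem (0, j) (by simp)]
  · have hmem : A.mode (j - M) u v ∈ A.starSpace g ε 0 := by
      rw [← hrs, A.starSpace_mod hε]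
      exact A.mode_mem_starSpace hg hu' hv' _
    rw [map_smul, LinearMap.smul_apply,
      A.star_eq_res hε hT (A.mode_mem_halfDeg hu hv _) hmem, hβ, neg_add_eq_sub]
    simp only [Ring.choose_zero_right, Int.cast_one, one_mul]
    congr 5
    push_cast
    ring
  · intro st hst hne
    have hst' : st.1 + st.2 = j := Finset.HasAntidiagonal.mem_antidiagonal.1 hst
    have h0 : 0 < st.1 := Nat.pos_of_ne_zero fun h => hne (Prod.ext h (by simp; omega))
    rw [Ring.choose_zero_pos ℤ h0, Int.cast_zero, zero_mul, zero_smul]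

/-- `(u ∘_g^n v) *_g w ∈ O_g(V)` when the eigenvalues of `g σ` on `u` and `v` are inverse to each
other: both sides of the iterate formula are sums of generators of `O_g(V)`. -/
theorem circ_star_mem_O_of_mod_eq_zero {k k' : ℤ} {r s : ℕ} (hr : r < A.T₀ g) (hs : s < A.T₀ g)
    (hrs : (r + s) % A.T₀ g = 0) {u v : V} (hu : u ∈ A.halfDeg k) (hu' : u ∈ A.starSpace g ε r)
    (hv : v ∈ A.halfDeg k') (hv' : v ∈ A.starSpace g ε s) (n : ℕ) (w : V) :
    A.star g ε (A.circ g ε n u v) w ∈ A.O g ε := by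
  -- the exponent `β` demanded by the iterate formula is that of `v ∘_g^0 w`, raised by `n + 1`
  have hpole : twistPole r = twistPole s ∧ twistExp (A.T₀ g) k r +
      (twistExp (A.T₀ g) k' s + ((n + 1 : ℕ) : ℚ)) =
        ((k + k' : ℤ) : ℚ) / 2 + ((twistPole r + n : ℤ) : ℚ) - 1 := by
    rcases eq_or_ne r 0 with rfl | hr0
    · obtain rfl : s = 0 := by rwa [zero_add, Nat.mod_eq_of_lt hs] at hrs
      refine ⟨rfl, ?_⟩
      rw [twistExp_zero, twistExp_zero, twistPole, if_pos rfl]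
      push_cast
      ring
    · have hT₀ : r + s = A.T₀ g := by
        obtain ⟨c, hc⟩ := Nat.dvd_of_mod_eq_zero hrs
        have h1 : c < 2 := by
          by_contra! h
          have := Nat.mul_le_mul_left (A.T₀ g) h
          omega
        interval_cases c <;> omega
      have hs0 : s ≠ 0 := by omega
      have hq : (A.T₀ g : ℚ) ≠ 0 := by exact_mod_cast (by omega : A.T₀ g ≠ 0)
      have hfrac : (r : ℚ) / A.T₀ g + (s : ℚ) / A.T₀ g = 1 := by
        rw [← add_div, div_eq_one_iff_eq hq]
        exact_mod_cast hT₀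
      rw [twistExp, twistExp, twistPole, twistPole, if_neg hr0, if_neg hr0, if_neg hs0, if_neg hs0]
      refine ⟨rfl, ?_⟩
      push_cast
      linear_combination hfrac
  obtain ⟨J, hJ⟩ := (A.eventually_star_res p h2 hε hT hg hrs hu hu' hv hv' w
    (twistExp_mem_pIntegers (p := p) h2 hT k r) (twistPole r + n) hpole.2).exists
  rw [A.circ_eq_res hε hT n hr hu hu', hJ]
  refine sub_mem (sum_mem fun j _ => zsmul_mem ?_ _)
    (zsmul_mem (sum_mem fun j _ => zsmul_mem ?_ _) _)
  · have := A.res_mem_O p h2 hε hT hr hu hu'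
      (A.res (twistExp (A.T₀ g) k' s + ((n + 1 : ℕ) : ℚ)) (1 - j) v w) (s := 0) (n := n + j)
      (Nat.zero_le _)
    rwa [Nat.cast_zero, add_zero, Nat.cast_add, ← add_assoc] at this
  · have := A.res_mem_O p h2 hε hT hs hv hv'
      (A.res (twistExp (A.T₀ g) k r) (-j) u w) (s := n + 1) (n := n + 1 + j) (Nat.le_add_right _ _)
    rwa [hpole.1, show twistPole s + n + 1 + j = twistPole s + ((n + 1 + j : ℕ) : ℤ) by
      push_cast; ring]

/-- Associativity on `V^{0*}`: in the iterate formula only the leading term does not lie in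
`O_g(V)`. -/
theorem star_star_sub_mem_O {k k' : ℤ} {u v : V} (hu : u ∈ A.halfDeg k)
    (hu' : u ∈ A.starSpace g ε 0) (hv : v ∈ A.halfDeg k') (hv' : v ∈ A.starSpace g ε 0) (w : V) :
    A.star g ε (A.star g ε u v) w - A.star g ε u (A.star g ε v w) ∈ A.O g ε := by
  have hpos : 0 < A.T₀ g := Nat.pos_of_ne_zero fun h => hT (by simp [h])
  have hk := twistExp_mem_pIntegers (p := p) h2 hT k 0
  rw [twistExp_zero] at hk
  -- a cut-off of the form `J + 1` allows the leading term to be split off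
  obtain ⟨J, hJ⟩ := ((tendsto_add_atTop_nat 1).eventually (A.eventually_star_res p h2 hε hT hg
    (Nat.zero_mod _) hu hu' hv hv' w hk (β := (k' : ℚ) / 2) 1 (by push_cast; ring))).exists
  rw [A.star_eq_res hε hT hu hu', hJ, Finset.sum_range_succ', A.star_eq_res hε hT hu hu',
    A.star_eq_res hε hT hv hv']
  simp only [Nat.cast_zero, add_zero, sub_zero, pow_zero, one_mul, Ring.choose_zero_right, one_smul]
  rw [sub_right_comm, add_sub_cancel_right]
  refine sub_mem (sum_mem fun j _ => zsmul_mem ?_ _)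
    (zsmul_mem (sum_mem fun j _ => zsmul_mem ?_ _) _)
  · have := A.res_mem_O p h2 hε hT hpos hu hu'
      (A.res ((k' : ℚ) / 2) (1 - ((j + 1 : ℕ) : ℤ)) v w) (s := 0) (n := j) (Nat.zero_le _)
    rw [twistExp_zero, Nat.cast_zero, add_zero, twistPole, if_pos rfl] at this
    convert this using 4
    push_cast
    ring
  · have := A.res_mem_O p h2 hε hT hpos hv hv' (A.res ((k : ℚ) / 2) (-j) u w) (s := 0)
      (n := j) (Nat.zero_le _)
    rwa [twistExp_zero, Nat.cast_zero, add_zero] at this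

end HalfGradedVertexSuperalgebra

/-! ### The ideal `O_g(V)` and the quotient algebra -/

namespace HalfGradedVertexSuperalgebra

open Filter

variable {F V : Type*} [Field F] [AddCommGroup V] [Module F V]
  (A : HalfGradedVertexSuperalgebra F V) {g : V ≃ₗ[F] V} {ε : F}

section Parity

theorem mode_mem_parity {a b : ZMod 2} {u v : V} (hu : u ∈ A.parity a) (hv : v ∈ A.parity b)
    (n : ℤ) : A.mode n u v ∈ A.parity (a + b) :=
  A.parity_ncoeff a b u hu v hv n

theorem res_mem_parity {a b : ZMod 2} {u v : V} (hu : u ∈ A.parity a) (hv : v ∈ A.parity b)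
    (α : ℚ) (m : ℤ) : A.res α m u v ∈ A.parity (a + b) := by
  obtain ⟨K, hK⟩ := (A.eventually_res_eq_sum α m u v).exists
  rw [← hK]
  exact sum_mem fun i _ => Submodule.smul_mem _ _ (A.mode_mem_parity hu hv _)

variable (hgdeg : ∀ (k : ℤ), ∀ v ∈ A.halfDeg k, g v ∈ A.halfDeg k)
include hgdeg

theorem starProj_mem_parity (ε : F) (r : ℕ) {a : ZMod 2} {u : V} (hu : u ∈ A.parity a) :
    A.starProj g ε r u ∈ A.parity a :=
  A.starProj_mem_of_stable (A.mul_sigma_mem_parity hgdeg a) ε r hu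

theorem star_mem_parity (ε : F) {a b : ZMod 2} {u v : V} (hu : u ∈ A.parity a)
    (hv : v ∈ A.parity b) : A.star g ε u v ∈ A.parity (a + b) :=
  A.halfDeg_induction_of_mem_parity (P := fun u => A.star g ε u v ∈ A.parity (a + b))
    (fun u u' h h' => by rw [map_add, LinearMap.add_apply]; exact add_mem h h')
    (fun k hk u hu => by
      rw [star, extendBySummands_of_mem _ _ hu, LinearMap.comp_apply]
      exact A.res_mem_parity
        (A.starProj_mem_parity hgdeg ε 0 (hk ▸ A.mem_parity_of_mem_halfDeg hu)) hv _ _) hu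

theorem circ_mem_parity (ε : F) (n : ℕ) {a b : ZMod 2} {u v : V} (hu : u ∈ A.parity a)
    (hv : v ∈ A.parity b) : A.circ g ε n u v ∈ A.parity (a + b) :=
  A.halfDeg_induction_of_mem_parity (P := fun u => A.circ g ε n u v ∈ A.parity (a + b))
    (fun u u' h h' => by rw [map_add, LinearMap.add_apply]; exact add_mem h h')
    (fun k hk u hu => by
      rw [circ, extendBySummands_of_mem _ _ hu, LinearMap.add_apply, LinearMap.sum_apply,
        LinearMap.add_apply, LinearMap.sum_apply]
      have hp : ∀ r, A.starProj g ε r u ∈ A.parity a := fun r =>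
        A.starProj_mem_parity hgdeg ε r (hk ▸ A.mem_parity_of_mem_halfDeg hu)
      exact add_mem (A.res_mem_parity (hp 0) hv _ _)
        (sum_mem fun r _ => A.res_mem_parity (hp r) hv _ _)) hu

/-- `O_g(V)` is a graded subspace for the parity grading. -/
theorem componentMap_parity_mem_O (ε : F) (c : ZMod 2) {x : V} (hx : x ∈ A.O g ε) :
    componentMap A.parity_isInternal c x ∈ A.O g ε := by
  induction hx using Submodule.span_induction with
  | zero => rw [map_zero]; exact zero_mem _
  | add x y _ _ hx hy => rw [map_add]; exact add_mem hx hy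
  | smul t x _ hx => rw [map_smul]; exact Submodule.smul_mem _ _ hx
  | mem x hx =>
    obtain ⟨n, u, v, rfl⟩ := hx
    induction u using A.parity_induction with
    | hadd u u' h h' => rw [map_add, LinearMap.add_apply, map_add]; exact add_mem h h'
    | h a u hu =>
      induction v using A.parity_induction with
      | hadd v v' h h' => rw [map_add, map_add]; exact add_mem h h'
      | h b v hv =>
        have hmem := A.circ_mem_parity hgdeg ε n hu hv
        rcases eq_or_ne c (a + b) with rfl | hc
        · rw [componentMap_same _ hmem]
          exact A.circ_mem_O n u v
        · rw [componentMap_of_ne _ hc hmem]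
          exact zero_mem _

theorem isInternal_map_parity (ε : F) :
    DirectSum.IsInternal (fun α : ZMod 2 => (A.parity α).map (A.O g ε).mkQ) := by
  rw [DirectSum.isInternal_submodule_iff_isCompl _ (zero_ne_one' (ZMod 2))
    (by ext a; simpa using (by decide : ∀ a : ZMod 2, a = 0 ∨ a = 1) a)]
  constructor
  · rw [Submodule.disjoint_def]
    rintro _ ⟨u, hu, rfl⟩ ⟨v, hv, huv⟩
    have hsub : u - v ∈ A.O g ε := by
      rwa [← Submodule.Quotient.mk_eq_zero, Submodule.Quotient.mk_sub, sub_eq_zero, eq_comm]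
    have h0 := A.componentMap_parity_mem_O hgdeg ε 0 hsub
    rw [map_sub, componentMap_same _ hu, componentMap_of_ne _ zero_ne_one hv, sub_zero] at h0
    exact (Submodule.Quotient.mk_eq_zero _).2 h0
  · rw [codisjoint_iff, eq_top_iff, ← Submodule.map_sup]
    rintro x -
    obtain ⟨v, rfl⟩ := (A.O g ε).mkQ_surjective x
    refine Submodule.mem_map_of_mem ?_
    rw [← componentMap_sum_zmod_two A.parity_isInternal v]
    exact Submodule.add_mem_sup (componentMap_mem _ 0 v) (componentMap_mem _ 1 v)

end Parity

section Unit

theorem res_one_vac (α : ℚ) (u : V) : A.res α 1 u A.vac = u := by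
  rw [A.res_eq_sum_of_le (N := 0) (fun n hn => A.creation_regular u n hn) α (K := 1) (by simp)]
  simpa [VertexSuperalgebra.mode_apply] using A.creation u

variable (hε : IsPrimitiveRoot ε (A.T₀ g)) (hT : (A.T₀ g : F) ≠ 0)
include hε hT

theorem vac_star (hg : A.IsAutomorphism g) (v : V) : A.star g ε A.vac v = v := by
  rw [A.star_eq_res hε hT A.vac_mem_halfDeg (A.vac_mem_starSpace hg ε), Int.cast_zero, zero_div,
    A.res_zero_left]
  exact (A.vacuum (-1) v).trans (if_pos rfl)

theorem star_vac_sub_mem_O (hgdeg : ∀ (k : ℤ), ∀ v ∈ A.halfDeg k, g v ∈ A.halfDeg k) (u : V) :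
    A.star g ε u A.vac - u ∈ A.O g ε := by
  induction u using A.bihomogeneous_induction hgdeg hε hT with
  | hadd u v hu hv =>
    rw [map_add, LinearMap.add_apply, add_sub_add_comm]
    exact add_mem hu hv
  | h k r hr u hu hu' =>
    rcases eq_or_ne r 0 with rfl | h0
    · rw [A.star_eq_res hε hT hu hu', A.res_one_vac, sub_self]
      exact zero_mem _
    · -- here `u ∘_g^0 1 = u`, so that `u` itself lies in `O_g(V)`
      have h := A.circ_mem_O (g := g) (ε := ε) 0 u A.vac
      rw [A.circ_eq_res hε hT 0 hr hu hu', twistPole, if_neg h0, Nat.cast_zero, add_zero,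
        A.res_one_vac] at h
      rw [A.star_eq_zero hε hT (by rwa [Nat.mod_eq_of_lt hr]) hu hu', zero_sub]
      exact neg_mem h

end Unit

theorem star_res_eq_zero (hε : IsPrimitiveRoot ε (A.T₀ g)) (hT : (A.T₀ g : F) ≠ 0)
    (hg : A.IsAutomorphism g) {k k' : ℤ} {r s : ℕ} (hrs : (r + s) % A.T₀ g ≠ 0) {u v : V}
    (hu : u ∈ A.halfDeg k) (hu' : u ∈ A.starSpace g ε r) (hv : v ∈ A.halfDeg k')
    (hv' : v ∈ A.starSpace g ε s) (w : V) (α : ℚ) (m : ℤ) :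
    A.star g ε (A.res α m u v) w = 0 := by
  obtain ⟨K, hK⟩ := (A.eventually_res_eq_sum α m u v).exists
  rw [← hK, map_sum, LinearMap.sum_apply]
  refine Finset.sum_eq_zero fun i _ => ?_
  rw [map_smul, LinearMap.smul_apply, A.star_eq_zero hε hT hrs (A.mode_mem_halfDeg hu hv _)
    (A.mode_mem_starSpace hg hu' hv' _), smul_zero]

variable (p : ℕ) [Fact p.Prime] [CharP F p]
variable (h2 : (2 : F) ≠ 0) (hε : IsPrimitiveRoot ε (A.T₀ g)) (hT : (A.T₀ g : F) ≠ 0)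
variable (hg : A.IsAutomorphism g)
variable (hgdeg : ∀ (k : ℤ), ∀ v ∈ A.halfDeg k, g v ∈ A.halfDeg k)
include p h2 hε hT hg hgdeg

theorem star_mem_O_right (a : V) {x : V} (hx : x ∈ A.O g ε) : A.star g ε a x ∈ A.O g ε := by
  induction hx using Submodule.span_induction with
  | zero => rw [map_zero]; exact zero_mem _
  | add x y _ _ hx hy => rw [map_add]; exact add_mem hx hy
  | smul t x _ hx => rw [map_smul]; exact Submodule.smul_mem _ _ hx
  | mem x hx =>
    obtain ⟨n, u, w, rfl⟩ := hx
    induction u using A.bihomogeneous_induction hgdeg hε hT with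
    | hadd u u' h h' => rw [map_add, LinearMap.add_apply, map_add]; exact add_mem h h'
    | h k' r hr u hu hu' =>
      induction a using A.bihomogeneous_induction hgdeg hε hT with
      | hadd a a' h h' => rw [map_add, LinearMap.add_apply]; exact add_mem h h'
      | h k s hs a ha ha' =>
        rcases eq_or_ne s 0 with rfl | h0
        · exact A.star_circ_mem_O p h2 hε hT hg hr ha ha' hu hu' n w
        · rw [A.star_eq_zero hε hT (by rwa [Nat.mod_eq_of_lt hs]) ha ha']
          exact zero_mem _

theorem star_mem_O_left {x : V} (hx : x ∈ A.O g ε) (a : V) : A.star g ε x a ∈ A.O g ε := by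
  induction hx using Submodule.span_induction with
  | zero => rw [map_zero]; exact zero_mem _
  | add x y _ _ hx hy => rw [map_add, LinearMap.add_apply]; exact add_mem hx hy
  | smul t x _ hx => rw [map_smul, LinearMap.smul_apply]; exact Submodule.smul_mem _ _ hx
  | mem x hx =>
    obtain ⟨n, u, v, rfl⟩ := hx
    induction u using A.bihomogeneous_induction hgdeg hε hT with
    | hadd u u' h h' =>
      rw [map_add, LinearMap.add_apply, map_add, LinearMap.add_apply]
      exact add_mem h h'
    | h k r hr u hu hu' =>
      induction v using A.bihomogeneous_induction hgdeg hε hT with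
      | hadd v v' h h' =>
        rw [map_add, map_add, LinearMap.add_apply]
        exact add_mem h h'
      | h k' s hs v hv hv' =>
        by_cases hrs : (r + s) % A.T₀ g = 0
        · exact A.circ_star_mem_O_of_mod_eq_zero p h2 hε hT hg hr hs hrs hu hu' hv hv' n a
        · rw [A.circ_eq_res hε hT n hr hu hu', A.star_res_eq_zero hε hT hg hrs hu hu' hv hv']
          exact zero_mem _

theorem star_assoc_mem_O (u v w : V) :
    A.star g ε (A.star g ε u v) w - A.star g ε u (A.star g ε v w) ∈ A.O g ε := by
  induction u using A.bihomogeneous_induction hgdeg hε hT with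
  | hadd u u' h h' =>
    simp only [map_add, LinearMap.add_apply]
    rw [add_sub_add_comm]
    exact add_mem h h'
  | h k r hr u hu hu' =>
    rcases eq_or_ne r 0 with rfl | hr0
    · induction v using A.bihomogeneous_induction hgdeg hε hT with
      | hadd v v' h h' =>
        simp only [map_add, LinearMap.add_apply]
        rw [add_sub_add_comm]
        exact add_mem h h'
      | h k' s hs v hv hv' =>
        rcases eq_or_ne s 0 with rfl | hs0
        · exact A.star_star_sub_mem_O p h2 hε hT hg hu hu' hv hv' w
        · rw [A.star_eq_res hε hT hu hu', A.star_res_eq_zero hε hT hg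
            (by rwa [zero_add, Nat.mod_eq_of_lt hs]) hu hu' hv hv',
            A.star_eq_zero hε hT (by rwa [Nat.mod_eq_of_lt hs]) hv hv', map_zero, sub_zero]
          exact zero_mem _
    · have h0 : ∀ x, A.star g ε u x = 0 :=
        A.star_eq_zero hε hT (by rwa [Nat.mod_eq_of_lt hr]) hu hu'
      rw [h0, h0, map_zero, LinearMap.zero_apply, sub_zero]
      exact zero_mem _

end HalfGradedVertexSuperalgebra

theorem mainTheorem2 {F V : Type*} [Field F] [IsAlgClosed F] {p : ℕ} [CharP F p]
    (hp : p.Prime) (hp2 : 2 < p) [AddCommGroup V] [Module F V]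
    (A : HalfGradedVertexSuperalgebra F V) (g : V ≃ₗ[F] V) (hg : A.IsAutomorphism g)
    (hgdeg : ∀ (k : ℤ), ∀ v ∈ A.halfDeg k, g v ∈ A.halfDeg k)
    (hT : (orderOf g).Coprime p)
    (ε : F) (hε : IsPrimitiveRoot ε (A.T₀ g)) :
    -- `O_g(V)` is a two-sided ideal of `(V, *_g)`
    (∀ a : V, ∀ x ∈ A.O g ε, A.star g ε a x ∈ A.O g ε ∧ A.star g ε x a ∈ A.O g ε) ∧
    -- `*_g` induces a bilinear product on the quotient
    ∃ μ : (V ⧸ A.O g ε) →ₗ[F] (V ⧸ A.O g ε) →ₗ[F] (V ⧸ A.O g ε),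
      (∀ u v : V, μ ((A.O g ε).mkQ u) ((A.O g ε).mkQ v) = (A.O g ε).mkQ (A.star g ε u v)) ∧
      -- which is associative
      (∀ x y z : V ⧸ A.O g ε, μ (μ x y) z = μ x (μ y z)) ∧
      -- with identity the class of the vacuum
      (∀ x : V ⧸ A.O g ε, μ ((A.O g ε).mkQ A.vac) x = x ∧ μ x ((A.O g ε).mkQ A.vac) = x) ∧
      -- and the parity of `V` induces a superalgebra grading
      DirectSum.IsInternal (fun α : ZMod 2 => (A.parity α).map (A.O g ε).mkQ) ∧
      (∀ α β : ZMod 2, ∀ x ∈ (A.parity α).map (A.O g ε).mkQ,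
        ∀ y ∈ (A.parity β).map (A.O g ε).mkQ, μ x y ∈ (A.parity (α + β)).map (A.O g ε).mkQ) ∧
      (A.O g ε).mkQ A.vac ∈ (A.parity 0).map (A.O g ε).mkQ := by
  have : Fact p.Prime := ⟨hp⟩
  have h2 : (2 : F) ≠ 0 := by
    intro h
    have hdvd := (CharP.cast_eq_zero_iff F p 2).1 (by exact_mod_cast h)
    exact absurd (Nat.le_of_dvd two_pos hdvd) (by omega)
  have hT₀ := A.T₀_cast_ne_zero hgdeg hp hp2 hT
  have hR : ∀ a : V, ∀ x ∈ A.O g ε, A.star g ε a x ∈ A.O g ε := fun a _ hx =>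
    A.star_mem_O_right p h2 hε hT₀ hg hgdeg a hx
  have hL : ∀ a : V, ∀ x ∈ A.O g ε, A.star g ε x a ∈ A.O g ε := fun a _ hx =>
    A.star_mem_O_left p h2 hε hT₀ hg hgdeg hx a
  let μ : (V ⧸ A.O g ε) →ₗ[F] (V ⧸ A.O g ε) →ₗ[F] (V ⧸ A.O g ε) :=
    (A.O g ε).liftQ (((A.O g ε).liftQ ((A.star g ε).compr₂ (A.O g ε).mkQ).flip (fun x hx =>
      LinearMap.ext fun a => (Submodule.Quotient.mk_eq_zero _).2 (hR a x hx))).flip) (fun x hx => by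
        refine LinearMap.ext fun y => ?_
        obtain ⟨a, rfl⟩ := (A.O g ε).mkQ_surjective y
        exact (Submodule.Quotient.mk_eq_zero _).2 (hL a x hx))
  have hμ : ∀ u v : V, μ ((A.O g ε).mkQ u) ((A.O g ε).mkQ v) =
      (A.O g ε).mkQ (A.star g ε u v) := fun _ _ => rfl
  refine ⟨fun a x hx => ⟨hR a x hx, hL a x hx⟩, μ, hμ, ?_, ?_, A.isInternal_map_parity hgdeg ε, ?_,
    Submodule.mem_map_of_mem A.vac_mem_parity⟩
  · intro x y z
    obtain ⟨u, rfl⟩ := (A.O g ε).mkQ_surjective x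
    obtain ⟨v, rfl⟩ := (A.O g ε).mkQ_surjective y
    obtain ⟨w, rfl⟩ := (A.O g ε).mkQ_surjective z
    rw [hμ, hμ, hμ, hμ]
    exact (Submodule.Quotient.eq _).2 (A.star_assoc_mem_O p h2 hε hT₀ hg hgdeg u v w)
  · intro x
    obtain ⟨u, rfl⟩ := (A.O g ε).mkQ_surjective x
    rw [hμ, hμ, A.vac_star hε hT₀ hg]
    exact ⟨rfl, (Submodule.Quotient.eq _).2 (A.star_vac_sub_mem_O hε hT₀ hgdeg u)⟩
  · rintro a b _ ⟨u, hu, rfl⟩ _ ⟨v, hv, rfl⟩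
    rw [hμ]
    exact Submodule.mem_map_of_mem (A.star_mem_parity hgdeg ε hu hv)
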